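/- Let $\tau>0$ and $Q(z)=|z|^2$ on $\mathbb C$, and let $dA=dx\,dy/\pi$. For $m>0$ and an integer $n\ge 1$ let $K_{m,n}$ be the reproducing kernel of the space of polynomials in $z$ of degree at most $n-1$ with the inner product $\langle u,v\rangle=\int_{\mathbb C}u\bar v\,e^{-mQ}\,dA$, and for $z_0\in\mathbb C$ let $$dB_{m,n}^{\langle z_0\rangle}(z)=\frac{|K_{m,n}(z,z_0)|^2}{K_{m,n}(z_0,z_0)}\,e^{-mQ(z)}\,dA(z)$$ be the Berezin measure at $z_0$. Let $\widehat Q_\tau(z)$ be the supremum of $f(z)$ over all subharmonic $f:\mathbb C\to\mathbb R$ with $f\le Q$ on $\mathbb C$ and $f(w)\le\tau\log|w|^2+O(1)$ as $w\to\infty$, and let $\mathcal S_\tau=\{Q=\widehat Q_\tau\}$. Then $\mathcal S_\tau$ is the closed disc $\{|z|\le\sqrt\tau\}$. Moreover, let $z_0\in\mathbb C\setminus\mathcal S_\tau$. Then every $B_{m,n}^{\langle z_0\rangle}$ is a probability measure, the harmonic measure $\omega$ at $z_0$ with respect to the domain $\mathbb C^*\setminus\mathcal S_\tau$ in the extended plane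 $\mathbb C^*=\mathbb C\cup\{\infty\}$ exists and is unique, and $$\int_{\mathbb C}f\,dB_{m,n}^{\langle z_0\rangle}\longrightarrow\int_{\mathbb C} f\,d\omega\qquad\text{as } m\to\infty \text{ and } n/m\to\tau,$$ for every bounded continuous $f:\mathbb C\to\mathbb R$. Here harmonic measure is the Borel probability measure $\omega$ on $\partial\mathcal S_\tau$ such that for each continuous $\varphi:\partial\mathcal S_\tau\to\mathbb R$ the solution $h$ of the Dirichlet problem ($h$ continuous on the closure of $\mathbb C^*\setminus\mathcal S_\tau$ and harmonic in $\mathbb C^*\setminus\mathcal S_\tau$, including at $\infty$, with $h=\varphi$ on $\partial\mathcal S_\tau$) satisfies $h(z_0)=\int\varphi\,d\omega$. -/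

import Mathlib

open MeasureTheory Filter Topology

noncomputable section

namespace Berezin

/-- The normalized area measure `dA = dx dy / π` on `ℂ`. -/
def areaMeasure : Measure ℂ := ENNReal.ofReal Real.pi⁻¹ • volume

/-- The measure `e^{-φ} dA`. -/
def weightedMeasure (φ : ℂ → ℝ) : Measure ℂ :=
  areaMeasure.withDensity (fun z => ENNReal.ofReal (Real.exp (-φ z)))

/-- The analytic polynomials of degree at most `n - 1` which lie in `L²(ℂ, μ)`. -/
def polySpace (μ : Measure ℂ) (n : ℕ) : Set (Polynomial ℂ) :=
  {p | p ∈ Polynomial.degreeLT ℂ n ∧ MemLp (fun z => p.eval z) 2 μ}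

/-- `K` is a reproducing kernel of the space `polySpace μ n` with the inner product of `L²(ℂ, μ)`:
each `K(·, w)` is in the space, and `u(w) = ⟨u, K(·, w)⟩` for all `u` in the space. -/
structure IsReproducingKernel (μ : Measure ℂ) (n : ℕ) (K : ℂ → ℂ → ℂ) : Prop where
  mem : ∀ w : ℂ, ∃ p ∈ polySpace μ n, ∀ z : ℂ, K z w = p.eval z
  reproducing : ∀ u ∈ polySpace μ n, ∀ w : ℂ,
    u.eval w = ∫ z, u.eval z * (starRingEnd ℂ) (K z w) ∂μ

open Classical in
/-- The reproducing kernel of `polySpace μ n` (it is unique whenever it exists). -/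
def reproducingKernel (μ : Measure ℂ) (n : ℕ) : ℂ → ℂ → ℂ :=
  if h : ∃ K, IsReproducingKernel μ n K then h.choose else 0

/-- The Berezin measure `|K(z, z₀)|² / K(z₀, z₀) dμ(z)` associated with `μ`, `n` and `z₀`. -/
def berezinMeasureOf (μ : Measure ℂ) (n : ℕ) (z₀ : ℂ) : Measure ℂ :=
  μ.withDensity (fun z => ENNReal.ofReal
    (‖reproducingKernel μ n z z₀‖ ^ 2 / (reproducingKernel μ n z₀ z₀).re))

/-- The Berezin measure `B_{m,n}^{⟨z₀⟩}` of the weight `Q`, i.e. the one for `e^{-mQ} dA`. -/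
def berezinMeasure (Q : ℂ → ℝ) (m : ℝ) (n : ℕ) (z₀ : ℂ) : Measure ℂ :=
  berezinMeasureOf (weightedMeasure (fun z => m * Q z)) n z₀

/-- Real-valued subharmonic functions on `ℂ`: upper semicontinuous functions with the
sub-mean value property on all circles. -/
structure IsSubharmonic (f : ℂ → ℝ) : Prop where
  upperSemicontinuous : UpperSemicontinuous f
  circleIntegrable : ∀ (c : ℂ) (r : ℝ), 0 < r → CircleIntegrable f c r
  le_circleAverage : ∀ (c : ℂ) (r : ℝ), 0 < r → f c ≤ Real.circleAverage f c r

/-- The class `SH_τ` of subharmonic functions `f` on `ℂ` with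
`f(z) ≤ τ log |z|² + O(1)` as `z → ∞`. -/
def subharmonicClass (τ : ℝ) : Set (ℂ → ℝ) :=
  {f | IsSubharmonic f ∧
    ∃ C : ℝ, ∀ᶠ z in cocompact ℂ, f z ≤ τ * Real.log (‖z‖ ^ 2) + C}

/-- The equilibrium potential: the pointwise supremum of the minorants of `Q` in `SH_τ`. -/
def equilibriumPotential (Q : ℂ → ℝ) (τ : ℝ) (z : ℂ) : ℝ :=
  sSup {x | ∃ f ∈ subharmonicClass τ, (∀ w, f w ≤ Q w) ∧ x = f z}

/-- The coincidence set `S_τ` of the obstacle problem. -/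
def coincidenceSet (Q : ℂ → ℝ) (τ : ℝ) : Set ℂ :=
  {z | Q z = equilibriumPotential Q τ z}

/-- The chart `z ↦ 1/z` at infinity of the extended plane `ℂ* = ℂ ∪ {∞}`. -/
def chartAtInfty (z : ℂ) : OnePoint ℂ :=
  if z = 0 then OnePoint.infty else ((z⁻¹ : ℂ) : OnePoint ℂ)

/-- `h` is harmonic on the open subset `Ω` of the extended plane: it is so in both of the
charts `z` and `1/z`. -/
structure IsHarmonicOnSphere (h : OnePoint ℂ → ℝ) (Ω : Set (OnePoint ℂ)) : Prop where
  finite : InnerProductSpace.HarmonicOnNhd (fun z : ℂ => h z) {z : ℂ | (z : OnePoint ℂ) ∈ Ω}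
  infinite : InnerProductSpace.HarmonicOnNhd (fun z : ℂ => h (chartAtInfty z))
    {z : ℂ | chartAtInfty z ∈ Ω}

/-- `h` solves the Dirichlet problem in `Ω ⊆ ℂ*` with boundary values `φ`. -/
structure IsDirichletSolution (Ω : Set (OnePoint ℂ)) (φ h : OnePoint ℂ → ℝ) : Prop where
  continuousOn : ContinuousOn h (closure Ω)
  harmonic : IsHarmonicOnSphere h Ω
  boundary : Set.EqOn h φ (frontier Ω)

/-- `ω` is harmonic measure at `z₀` with respect to `Ω`, where `Ω ⊆ ℂ*` is a domain with nonempty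
boundary in which the Dirichlet problem is solvable: `ω` is a probability measure carried by the
boundary of `Ω`, and for each continuous boundary function `φ` the solution of the Dirichlet
problem takes the value `∫ φ dω` at `z₀`. (The solution is unique by the maximum principle.
Harmonic measure does not charge single points, so it is regarded as a measure on `ℂ`.) -/
structure IsHarmonicMeasure (Ω : Set (OnePoint ℂ)) (z₀ : OnePoint ℂ) (ω : Measure ℂ) : Prop where
  isProbabilityMeasure : IsProbabilityMeasure ω
  carried : ∀ᵐ z : ℂ ∂ω, (z : OnePoint ℂ) ∈ frontier Ω
  dirichlet : ∀ φ : OnePoint ℂ → ℝ, ContinuousOn φ (frontier Ω) →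
    ∃ h : OnePoint ℂ → ℝ, IsDirichletSolution Ω φ h ∧ h z₀ = ∫ z : ℂ, φ z ∂ω

/-- The domain `ℂ* ∖ S` for `S ⊆ ℂ`. -/
def sphereCompl (S : Set ℂ) : Set (OnePoint ℂ) := (((↑) : ℂ → OnePoint ℂ) '' S)ᶜ

/-- The limit `m → ∞`, `n / m → τ` for pairs `(m, n)` of a real number and an integer. -/
def scalingLimit (τ : ℝ) : Filter (ℝ × ℕ) :=
  comap (fun p => p.1) atTop ⊓ comap (fun p => (p.2 : ℝ) / p.1) (𝓝 τ)

/-- The Bargmann-Fock weight `Q(z) = |z|²`. -/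
def fockWeight (z : ℂ) : ℝ := ‖z‖ ^ 2

end Berezin

end

noncomputable section

namespace Berezin

open Metric

/-! Coincidence set. As a function of `t = log |z|²`, the weight is `e^t`, and growth in `SH_τ`
means slope at most `τ`. The largest minorant should therefore follow `e^t` up to slope `τ` and
continue along the tangent line; this is `fockObstacle`. It is subharmonic because at each point
other than the origin it is touched from below by a tangent function `a log |z|² + a - a log a` with
`a ≤ τ`. The maximum principle outside the disc (`le_fockObstacle_of_mem`) shows that no competitor
exceeds it there, and there it lies strictly below `|z|²`.

Convergence. Monomials are orthogonal for `e^{-m|z|²} dA`, so the kernel is explicit and the moments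
of the Berezin measure are governed by the truncated exponentials `E_n(x) = ∑_{k<n} x^k / k!` at `x
= m|z₀|²`. When `|z₀|² > τ`, the ratio `E_{n-j}(x) / E_n(x)` tends to `(τ/|z₀|²)^j`
(`tendsto_expPartial_ratio`). Two facts follow: the moments of `|z|²` tend to powers of `τ`, so the
mass concentrates on the circle `|z|² = τ`; and the integral of `z^j` tends to `(τ / conj z₀)^j`,
the value of `z^j` at the reflection of `z₀` in that circle.

Harmonic measure has the same holomorphic moments: the inversion `z ↦ 1/z` turns the exterior into a
disc, where it is given by the Poisson kernel, and on the circle `1/ζ` is a multiple of `conj ζ`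
(`integral_re_eval_exteriorHarmonicMeasure`). Real parts of polynomials are dense in the continuous
functions on the circle. A bounded continuous `f` is thus replaced by some `Re p`, and the error off
the circle is dominated by a polynomial in `|z|²` that vanishes on it, whose Berezin integral tends
to `0`. -/

/-! ### Circle averages and a maximum principle. -/

theorem circleIntegrable_norm_sq (c : ℂ) (r : ℝ) : CircleIntegrable (fun z => ‖z‖ ^ 2) c r :=
  Continuous.continuousOn (by fun_prop) |>.circleIntegrable'

/-- On the circle itself `|z|²` agrees with a constant plus the real part of an affine function
vanishing at `c`, and the mean of this harmonic function is its value at `c`. -/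
theorem circleAverage_norm_sq (c : ℂ) (r : ℝ) :
    Real.circleAverage (fun z => ‖z‖ ^ 2) c r = ‖c‖ ^ 2 + r ^ 2 := by
  have h1 : Real.circleAverage (fun z => ‖z‖ ^ 2) c r =
      Real.circleAverage (fun z =>
        (((‖c‖ ^ 2 + r ^ 2 : ℝ) : ℂ) + 2 * (starRingEnd ℂ c) * (z - c)).re) c r := by
    refine Real.circleAverage_congr_sphere fun z hz => ?_
    have hz' : ‖z - c‖ ^ 2 = r ^ 2 := by
      rw [mem_sphere_iff_norm] at hz
      rw [hz, sq_abs]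
    have h2 : z = c + (z - c) := by ring
    generalize z - c = w at *
    subst h2
    rw [← hz', ← Complex.normSq_eq_norm_sq, ← Complex.normSq_eq_norm_sq, ← Complex.normSq_eq_norm_sq]
    simp [Complex.normSq_apply]
    ring
  rw [h1, InnerProductSpace.HarmonicOnNhd.circleAverage_eq]
  · simp only [sub_self, mul_zero, add_zero, Complex.ofReal_re]
  · intro x _
    refine AnalyticAt.harmonicAt_re ?_
    fun_prop

theorem circleAverage_log_norm (c : ℂ) {r : ℝ} (hr : 0 < r) :
    Real.circleAverage (fun z => Real.log (‖z‖ ^ 2)) c r =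
      2 * (Real.log r + Real.posLog (r⁻¹ * ‖c‖)) := by
  have h := circleAverage_log_norm_sub_const_eq_log_radius_add_posLog (a := 0) (c := c) hr.ne'
  rw [sub_zero] at h
  rw [← h]
  have h2 : (fun z : ℂ => Real.log (‖z‖ ^ 2)) = (2 : ℝ) • (fun z => Real.log ‖z - 0‖) := by
    ext z; simp
  rw [h2, Real.circleAverage_smul, smul_eq_mul]

theorem circleIntegrable_log_norm_sq (c : ℂ) (r : ℝ) :
    CircleIntegrable (fun z => Real.log (‖z‖ ^ 2)) c r := by
  have h2 : (fun z : ℂ => Real.log (‖z‖ ^ 2)) = (2 : ℝ) • (fun z => Real.log ‖z - 0‖) := by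
    ext z; simp
  rw [h2]
  exact (circleIntegrable_log_norm_sub_const r).const_smul

theorem log_norm_sq_le_circleAverage {c : ℂ} (hc : c ≠ 0) {r : ℝ} (hr : 0 < r) :
    Real.log (‖c‖ ^ 2) ≤ Real.circleAverage (fun z => Real.log (‖z‖ ^ 2)) c r := by
  rw [circleAverage_log_norm c hr, Real.log_pow]
  have hc' : 0 < ‖c‖ := norm_pos_iff.2 hc
  have h : Real.log (r⁻¹ * ‖c‖) ≤ Real.posLog (r⁻¹ * ‖c‖) := le_max_right _ _
  rw [Real.log_mul (by positivity) hc'.ne', Real.log_inv] at h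
  push_cast
  linarith

theorem circleAverage_log_norm_sq_of_le {c : ℂ} {r : ℝ} (hr : 0 < r) (hrc : r ≤ ‖c‖) :
    Real.circleAverage (fun z => Real.log (‖z‖ ^ 2)) c r = Real.log (‖c‖ ^ 2) := by
  have hc' : 0 < ‖c‖ := hr.trans_le hrc
  rw [circleAverage_log_norm c hr, Real.log_pow, Real.posLog_eq_log,
    Real.log_mul (by positivity) hc'.ne', Real.log_inv]
  · push_cast; ring
  · rw [abs_of_pos (by positivity), inv_mul_eq_div, le_div_iff₀ hr]; linarith

/-- The maximum principle for upper semicontinuous functions with a local sub-mean value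
property. -/
theorem le_of_le_circleAverage {K U : Set ℂ} (hK : IsCompact K) {u : ℂ → ℝ}
    (hu : UpperSemicontinuousOn u K) {M : ℝ} (hbd : ∀ z ∈ K, z ∉ U → u z ≤ M)
    (hmean : ∀ c ∈ U, ∃ r > 0, closedBall c r ⊆ K ∧ CircleIntegrable u c r ∧
      u c ≤ Real.circleAverage u c r) :
    ∀ z ∈ K, u z ≤ M := by
  intro z₁ hz₁
  by_contra! hlt
  obtain ⟨B, hB⟩ := hK.isBounded.exists_norm_le
  -- Adding `δ|z|²` makes the sub-mean value inequality strict, with surplus `δ r²`, so a maximum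
  -- cannot occur in `U`. The choice `δ B² < u z₁ - M` keeps the maximum of the perturbed function
  -- away from the points where `u ≤ M`.
  set δ : ℝ := (u z₁ - M) / (B ^ 2 + 1) with hδ
  have hδ0 : 0 < δ := div_pos (by linarith) (by positivity)
  have hδB : δ * B ^ 2 < u z₁ - M := by
    have : δ * (B ^ 2 + 1) = u z₁ - M := by rw [hδ]; field_simp
    nlinarith
  have hcont : Continuous (fun z : ℂ => δ * ‖z‖ ^ 2) := by fun_prop
  obtain ⟨c, hcK, hc⟩ := UpperSemicontinuousOn.exists_isMaxOn ⟨z₁, hz₁⟩ hK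
    (hu.add (hcont.upperSemicontinuous.upperSemicontinuousOn K))
  have hc1 := hc hz₁
  simp only [Set.mem_ofPred_eq] at hc1
  have hBc : ‖c‖ ^ 2 ≤ B ^ 2 := pow_le_pow_left₀ (norm_nonneg _) (hB c hcK) 2
  have hcU : c ∈ U := by
    by_contra hcU
    have := hbd c hcK hcU
    nlinarith [sq_nonneg ‖z₁‖]
  obtain ⟨r, hr, hrK, hint, hle⟩ := hmean c hcU
  have h1 : Real.circleAverage (fun z => u z + δ * ‖z‖ ^ 2) c r ≤ u c + δ * ‖c‖ ^ 2 := by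
    refine Real.circleAverage_mono_on_of_le_circle
      (hint.add ((circleIntegrable_norm_sq c r).const_smul (a := δ))) fun x hx => ?_
    rw [abs_of_pos hr] at hx
    exact hc (hrK (sphere_subset_closedBall hx))
  have hδint : CircleIntegrable (fun z => δ * ‖z‖ ^ 2) c r := hcont.continuousOn.circleIntegrable'
  have h2 : Real.circleAverage (fun z => δ * ‖z‖ ^ 2) c r = δ * (‖c‖ ^ 2 + r ^ 2) := by
    rw [← circleAverage_norm_sq, ← smul_eq_mul, ← Real.circleAverage_fun_smul]
    rfl
  rw [Real.circleAverage_fun_add hint hδint, h2] at h1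
  have h3 : 0 < δ * r ^ 2 := by positivity
  linarith

/-! ### The obstacle problem for `|z|²`. -/

/-- The function equal to `|z|²` on the disc `|z|² ≤ τ` and to `τ log |z|² + τ - τ log τ`
outside. -/
def fockObstacle (τ : ℝ) (z : ℂ) : ℝ :=
  min (‖z‖ ^ 2) τ + τ * Real.log (max (‖z‖ ^ 2) τ / τ)

theorem continuous_fockObstacle {τ : ℝ} (hτ : 0 < τ) : Continuous (fockObstacle τ) := by
  unfold fockObstacle
  refine Continuous.add (by fun_prop) (continuous_const.mul (Continuous.log (by fun_prop) ?_))
  intro x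
  have : 0 < max (‖x‖ ^ 2) τ := lt_max_of_lt_right hτ
  positivity

theorem fockObstacle_of_le {τ : ℝ} (hτ : 0 < τ) {z : ℂ} (hz : ‖z‖ ^ 2 ≤ τ) :
    fockObstacle τ z = ‖z‖ ^ 2 := by
  simp [fockObstacle, hz, hτ.ne']

theorem fockObstacle_of_ge {τ : ℝ} (hτ : 0 < τ) {z : ℂ} (hz : τ ≤ ‖z‖ ^ 2) :
    fockObstacle τ z = τ * Real.log (‖z‖ ^ 2) + (τ - τ * Real.log τ) := by
  rw [fockObstacle, min_eq_right hz, max_eq_left hz, Real.log_div (by linarith) hτ.ne']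
  ring

/-- In the variable `t = log x`, the left side is the tangent line to `e^t` at `t = log a`. -/
theorem mul_log_add_sub_le {a x : ℝ} (ha : 0 < a) (hx : 0 < x) :
    a * Real.log x + (a - a * Real.log a) ≤ x := by
  have h := Real.log_le_sub_one_of_pos (div_pos hx ha)
  rw [Real.log_div hx.ne' ha.ne'] at h
  have h2 := mul_le_mul_of_nonneg_left h ha.le
  rw [mul_sub, mul_sub, mul_div_cancel₀ _ ha.ne'] at h2
  linarith

theorem mul_log_add_sub_lt {a x : ℝ} (ha : 0 < a) (hx : a < x) :
    a * Real.log x + (a - a * Real.log a) < x := by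
  have hx0 := ha.trans hx
  have h := Real.log_lt_sub_one_of_pos (div_pos hx0 ha) (by rw [Ne, div_eq_one_iff_eq ha.ne']; exact hx.ne')
  rw [Real.log_div hx0.ne' ha.ne'] at h
  have h2 := mul_lt_mul_of_pos_left h ha
  rw [mul_sub, mul_sub, mul_div_cancel₀ _ ha.ne'] at h2
  linarith

theorem fockObstacle_le {τ : ℝ} (hτ : 0 < τ) (z : ℂ) : fockObstacle τ z ≤ ‖z‖ ^ 2 := by
  rcases le_total (‖z‖ ^ 2) τ with h | h
  · exact (fockObstacle_of_le hτ h).le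
  · rw [fockObstacle_of_ge hτ h]
    exact mul_log_add_sub_le hτ (by linarith)

/-- Inside the disc this is the tangent line inequality. Outside, it holds at `|z|² = τ` and
persists because the slope `a` in `log |z|²` is at most `τ`. -/
theorem log_le_fockObstacle {τ a : ℝ} (ha : 0 < a) (haτ : a ≤ τ) {z : ℂ} (hz : z ≠ 0) :
    a * Real.log (‖z‖ ^ 2) + (a - a * Real.log a) ≤ fockObstacle τ z := by
  have hτ := ha.trans_le haτ
  have hz' : 0 < ‖z‖ ^ 2 := by have := norm_pos_iff.2 hz; positivity
  rcases le_total (‖z‖ ^ 2) τ with h | h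
  · rw [fockObstacle_of_le hτ h]
    exact mul_log_add_sub_le ha hz'
  · rw [fockObstacle_of_ge hτ h]
    have h1 := mul_log_add_sub_le ha hτ
    have h2 := Real.log_le_log hτ h
    nlinarith

/-- The logarithmic minorants need this at the origin: the convention `Real.log 0 = 0` can break the
pointwise bound there, but a single point does not affect a circle average. -/
theorem le_circleAverage_of_le_off_point {f g : ℂ → ℝ} {c : ℂ} {r : ℝ} (hr : 0 < r)
    (hf : CircleIntegrable f c r) (hg : CircleIntegrable g c r) (p : ℂ)
    (h : ∀ z, z ≠ p → f z ≤ g z) : Real.circleAverage f c r ≤ Real.circleAverage g c r := by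
  have h1 : Real.circleAverage (fun z => if z = p then g z else f z) c r =
      Real.circleAverage f c r := by
    refine Real.circleAverage_congr_codiscreteWithin ?_ hr.ne'
    have : ({p}ᶜ : Set ℂ) ∈ codiscreteWithin (sphere c |r|) :=
      codiscreteWithin_mono (Set.subset_univ _) (by simp)
    filter_upwards [this] with z hz
    simp [show z ≠ p from hz]
  rw [← h1]
  refine Real.circleAverage_mono ?_ hg fun z _ => ?_
  · refine CircleIntegrable.congr_codiscreteWithin ?_ hf
    have : ({p}ᶜ : Set ℂ) ∈ codiscreteWithin (sphere c |r|) :=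
      codiscreteWithin_mono (Set.subset_univ _) (by simp)
    filter_upwards [this] with z hz
    simp [show z ≠ p from hz]
  · split_ifs with hz
    · exact le_rfl
    · exact h z hz

/-- At `c ≠ 0` the minorant with `a = min(|c|², τ)` touches at `c`, and its own sub-mean value
property passes to the larger function. At the origin the function attains its minimum `0`. -/
theorem isSubharmonic_fockObstacle {τ : ℝ} (hτ : 0 < τ) : IsSubharmonic (fockObstacle τ) where
  upperSemicontinuous := (continuous_fockObstacle hτ).upperSemicontinuous
  circleIntegrable c r _ := (continuous_fockObstacle hτ).continuousOn.circleIntegrable'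
  le_circleAverage c r hr := by
    by_cases hc : c = 0
    · subst hc
      rw [fockObstacle_of_le hτ (by simpa using hτ.le)]
      simp only [norm_zero, ne_eq, OfNat.ofNat_ne_zero, not_false_eq_true, zero_pow]
      refine Real.circleAverage_nonneg_of_nonneg fun z _ => ?_
      rcases le_total (‖z‖ ^ 2) τ with h | h
      · rw [fockObstacle_of_le hτ h]; positivity
      · rw [fockObstacle_of_ge hτ h]
        have := Real.log_le_log hτ h
        nlinarith
    have hc' : 0 < ‖c‖ ^ 2 := by have := norm_pos_iff.2 hc; positivity
    obtain ⟨a, ha, haτ, hac⟩ : ∃ a, 0 < a ∧ a ≤ τ ∧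
        fockObstacle τ c = a * Real.log (‖c‖ ^ 2) + (a - a * Real.log a) := by
      rcases le_total (‖c‖ ^ 2) τ with h | h
      · exact ⟨‖c‖ ^ 2, hc', h, by rw [fockObstacle_of_le hτ h]; ring⟩
      · exact ⟨τ, hτ, le_rfl, fockObstacle_of_ge hτ h⟩
    have hint := ((circleIntegrable_log_norm_sq c r).const_smul (a := a)).add
      (circleIntegrable_const (a - a * Real.log a) c r)
    have h1 := le_circleAverage_of_le_off_point hr hint
      (continuous_fockObstacle hτ).continuousOn.circleIntegrable' 0
      fun z hz => log_le_fockObstacle ha haτ hz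
    rw [Real.circleAverage_add ((circleIntegrable_log_norm_sq c r).const_smul (a := a))
      (circleIntegrable_const (a - a * Real.log a) c r), Real.circleAverage_smul,
      Real.circleAverage_const, smul_eq_mul] at h1
    rw [hac]
    refine le_trans ?_ h1
    have := mul_le_mul_of_nonneg_left (log_norm_sq_le_circleAverage hc hr) ha.le
    linarith

theorem fockObstacle_mem_subharmonicClass {τ : ℝ} (hτ : 0 < τ) :
    fockObstacle τ ∈ subharmonicClass τ := by
  refine ⟨isSubharmonic_fockObstacle hτ, τ - τ * Real.log τ, ?_⟩
  have h : Tendsto (fun z : ℂ => ‖z‖ ^ 2) (cocompact ℂ) atTop :=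
    (tendsto_pow_atTop two_ne_zero).comp (tendsto_norm_cocompact_atTop (E := ℂ))
  filter_upwards [h.eventually_ge_atTop τ] with z hz
  exact (fockObstacle_of_ge hτ hz).le

/-- The domination principle outside of the disc. -/
theorem le_fockObstacle_of_mem {τ : ℝ} (hτ : 0 < τ) {f : ℂ → ℝ} (hf : f ∈ subharmonicClass τ)
    (hfQ : ∀ w, f w ≤ fockWeight w) {z : ℂ} (hz : τ < ‖z‖ ^ 2) :
    f z ≤ τ * Real.log (‖z‖ ^ 2) + (τ - τ * Real.log τ) := by
  obtain ⟨hsub, C, hC⟩ := hf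
  have hlog : Tendsto (fun z : ℂ => Real.log (‖z‖ ^ 2)) (cocompact ℂ) atTop :=
    Real.tendsto_log_atTop.comp
      ((tendsto_pow_atTop two_ne_zero).comp (tendsto_norm_cocompact_atTop (E := ℂ)))
  -- The extra `ε` absorbs the `O(1)` term in the growth of `f`: the difference falls below any
  -- constant near infinity, so the maximum principle applies on a large annulus. Then `ε → 0`.
  have key : ∀ ε > 0, f z - (τ + ε) * Real.log (‖z‖ ^ 2) ≤ τ - (τ + ε) * Real.log τ := by
    intro ε hε
    have h1 : ∀ᶠ w in cocompact ℂ, f w - (τ + ε) * Real.log (‖w‖ ^ 2) ≤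
        τ - (τ + ε) * Real.log τ := by
      filter_upwards [hC, hlog.eventually_ge_atTop ((C - (τ - (τ + ε) * Real.log τ)) / ε)]
        with w hw1 hw2
      rw [div_le_iff₀ hε] at hw2
      linarith
    rw [← cobounded_eq_cocompact, ← comap_norm_atTop, eventually_comap] at h1
    obtain ⟨R₀, hR₀⟩ := eventually_atTop.1 h1
    set R := max R₀ (‖z‖ + 1)
    set K : Set ℂ := {w | τ ≤ ‖w‖ ^ 2} ∩ closedBall 0 R with hKdef
    set U : Set ℂ := {w | τ < ‖w‖ ^ 2} ∩ ball 0 R with hUdef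
    have hK : IsCompact K :=
      (isCompact_closedBall 0 R).inter_left (isClosed_le (by fun_prop) (by fun_prop))
    have hUo : IsOpen U := (isOpen_lt (by fun_prop) (by fun_prop)).inter isOpen_ball
    have hUK : U ⊆ K := fun w hw => by
      refine ⟨?_, ball_subset_closedBall hw.2⟩
      have := hw.1
      simp only [Set.mem_ofPred_eq] at this ⊢
      exact this.le
    refine le_of_le_circleAverage (K := K) (U := U)
      (u := fun w => f w + -((τ + ε) * Real.log (‖w‖ ^ 2))) hK ?_ ?_ ?_ z ⟨hz.le, ?_⟩
    · refine (hsub.upperSemicontinuous.upperSemicontinuousOn K).add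
        (ContinuousOn.upperSemicontinuousOn ?_)
      refine (continuousOn_const.mul (ContinuousOn.log (by fun_prop) ?_)).neg
      intro w hw
      exact (hτ.trans_le hw.1).ne'
    · intro w hw hwU
      by_cases hwR : ‖w‖ < R
      · have hwτ : ‖w‖ ^ 2 = τ := by
          refine le_antisymm ?_ hw.1
          by_contra! h
          exact hwU ⟨h, by simpa using hwR⟩
        have := hfQ w
        rw [fockWeight, hwτ] at this
        simp only [hwτ]
        linarith
      · exact hR₀ ‖w‖ (le_trans (le_max_left _ _) (not_lt.1 hwR)) w rfl
    · intro c hc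
      obtain ⟨r, hr, hrU⟩ := nhds_basis_closedBall.mem_iff.1 (hUo.mem_nhds hc)
      have hlogint := (circleIntegrable_log_norm_sq c r).const_smul (a := τ + ε)
      refine ⟨r, hr, hrU.trans hUK, (hsub.circleIntegrable c r hr).add hlogint.neg, ?_⟩
      have hrc : r ≤ ‖c‖ := by
        by_contra! h
        have h0 : (0 : ℂ) ∈ U := hrU (by simpa using h.le)
        have := h0.1
        simp only [Set.mem_ofPred_eq, norm_zero] at this
        norm_num at this
        linarith
      have h2 := Real.circleAverage_fun_sub (hsub.circleIntegrable c r hr) hlogint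
      rw [Real.circleAverage_smul, circleAverage_log_norm_sq_of_le hr hrc] at h2
      simp only [Pi.smul_apply, smul_eq_mul] at h2
      simp only [← sub_eq_add_neg]
      rw [h2]
      linarith [hsub.le_circleAverage c r hr]
    · simp only [mem_closedBall, dist_zero_right]
      exact le_trans (by linarith) (le_max_right _ _)
  have hlim : Tendsto (fun ε : ℝ => τ - (τ + ε) * Real.log τ + (τ + ε) * Real.log (‖z‖ ^ 2))
      (𝓝[>] 0) (𝓝 (τ - (τ + 0) * Real.log τ + (τ + 0) * Real.log (‖z‖ ^ 2))) :=
    (Continuous.tendsto (by fun_prop) 0).mono_left nhdsWithin_le_nhds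
  have h := ge_of_tendsto hlim (b := f z) (by
    filter_upwards [self_mem_nhdsWithin] with ε hε
    linarith [key ε hε])
  linarith

theorem coincidenceSet_fockWeight {τ : ℝ} (hτ : 0 < τ) :
    coincidenceSet fockWeight τ = closedBall (0 : ℂ) (Real.sqrt τ) := by
  ext z
  have hne : ({x | ∃ f ∈ subharmonicClass τ, (∀ w, f w ≤ fockWeight w) ∧ x = f z}).Nonempty :=
    ⟨_, _, fockObstacle_mem_subharmonicClass hτ, fockObstacle_le hτ, rfl⟩
  have hmem : z ∈ closedBall (0 : ℂ) (Real.sqrt τ) ↔ ‖z‖ ^ 2 ≤ τ := by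
    rw [mem_closedBall, dist_zero_right, Real.le_sqrt (norm_nonneg z) hτ.le]
  rw [hmem, coincidenceSet, Set.mem_ofPred_eq, equilibriumPotential]
  constructor
  · intro h
    by_contra! hz
    have h1 : sSup {x | ∃ f ∈ subharmonicClass τ, (∀ w, f w ≤ fockWeight w) ∧ x = f z} ≤
        τ * Real.log (‖z‖ ^ 2) + (τ - τ * Real.log τ) := by
      refine csSup_le hne ?_
      rintro x ⟨f, hf, hfQ, rfl⟩
      exact le_fockObstacle_of_mem hτ hf hfQ hz
    have h2 := mul_log_add_sub_lt hτ hz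
    rw [← h, fockWeight] at h1
    linarith
  · intro hz
    refine le_antisymm (le_csSup ⟨fockWeight z, ?_⟩
      ⟨_, fockObstacle_mem_subharmonicClass hτ, fockObstacle_le hτ,
        (fockObstacle_of_le hτ hz).symm⟩) (csSup_le hne ?_)
    · rintro x ⟨f, -, hfQ, rfl⟩
      exact hfQ z
    · rintro x ⟨f, -, hfQ, rfl⟩
      exact hfQ z

/-! ### The Bargmann-Fock kernel and the moments of its Berezin measure. -/

section Moments

/-- Functions on `ℂ` of at most polynomial growth. -/
def HasPolyGrowth {E : Type*} [Norm E] (f : ℂ → E) : Prop :=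
  ∃ (C : ℝ) (d : ℕ), ∀ z, ‖f z‖ ≤ C * (1 + ‖z‖ ^ 2) ^ d

theorem HasPolyGrowth.exists_nonneg {E : Type*} [Norm E] {f : ℂ → E} (hf : HasPolyGrowth f) :
    ∃ (C : ℝ) (d : ℕ), 0 ≤ C ∧ ∀ z, ‖f z‖ ≤ C * (1 + ‖z‖ ^ 2) ^ d := by
  obtain ⟨C, d, h⟩ := hf
  refine ⟨|C|, d, abs_nonneg C, fun z => (h z).trans ?_⟩
  gcongr
  exact le_abs_self C

theorem HasPolyGrowth.mul {A : Type*} [NormedRing A] {f g : ℂ → A} (hf : HasPolyGrowth f)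
    (hg : HasPolyGrowth g) : HasPolyGrowth (fun z => f z * g z) := by
  obtain ⟨C, d, hC, hf⟩ := hf.exists_nonneg
  obtain ⟨D, e, hD, hg⟩ := hg.exists_nonneg
  refine ⟨C * D, d + e, fun z => (norm_mul_le _ _).trans ?_⟩
  calc ‖f z‖ * ‖g z‖ ≤ (C * (1 + ‖z‖ ^ 2) ^ d) * (D * (1 + ‖z‖ ^ 2) ^ e) :=
        mul_le_mul (hf z) (hg z) (norm_nonneg _) (by positivity)
    _ = _ := by rw [pow_add]; ring

theorem HasPolyGrowth.add {E : Type*} [SeminormedAddCommGroup E] {f g : ℂ → E}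
    (hf : HasPolyGrowth f) (hg : HasPolyGrowth g) : HasPolyGrowth (fun z => f z + g z) := by
  obtain ⟨C, d, hC, hf⟩ := hf.exists_nonneg
  obtain ⟨D, e, hD, hg⟩ := hg.exists_nonneg
  refine ⟨C + D, max d e, fun z => (norm_add_le _ _).trans ?_⟩
  have h1 : (1 : ℝ) ≤ 1 + ‖z‖ ^ 2 := by nlinarith [sq_nonneg ‖z‖]
  rw [add_mul]
  refine add_le_add ((hf z).trans ?_) ((hg z).trans ?_) <;> gcongr <;> simp

theorem HasPolyGrowth.of_norm_le {E F : Type*} [Norm E] [Norm F] {f : ℂ → E} {g : ℂ → F}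
    (hf : HasPolyGrowth f) (h : ∀ z, ‖g z‖ ≤ ‖f z‖) : HasPolyGrowth g := by
  obtain ⟨C, d, hf⟩ := hf
  exact ⟨C, d, fun z => (h z).trans (hf z)⟩

theorem hasPolyGrowth_const {E : Type*} [Norm E] (a : E) : HasPolyGrowth (fun _ => a) :=
  ⟨‖a‖, 0, fun z => by simp⟩

theorem hasPolyGrowth_id : HasPolyGrowth (fun z : ℂ => z) := by
  refine ⟨1, 1, fun z => ?_⟩
  nlinarith [sq_nonneg (‖z‖ - 1)]

theorem HasPolyGrowth.pow {A : Type*} [NormedRing A] {f : ℂ → A}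
    (hf : HasPolyGrowth f) (n : ℕ) : HasPolyGrowth (fun z => f z ^ n) := by
  induction n with
  | zero => simpa using hasPolyGrowth_const (1 : A)
  | succ n ih => simpa [pow_succ] using ih.mul hf

theorem hasPolyGrowth_norm : HasPolyGrowth (fun z : ℂ => ‖z‖) :=
  hasPolyGrowth_id.of_norm_le fun z => by simp

theorem hasPolyGrowth_eval (p : Polynomial ℂ) : HasPolyGrowth (fun z => p.eval z) := by
  induction p using Polynomial.induction_on' with
  | add p q hp hq => simpa using hp.add hq
  | monomial n a => simpa using (hasPolyGrowth_const a).mul (hasPolyGrowth_id.pow n)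

/-- The measure `e^{-m|z|²} dA`. -/
abbrev fockMeasure (m : ℝ) : Measure ℂ := weightedMeasure (fun z => m * fockWeight z)

variable {m : ℝ}

theorem measurable_fockDensity (m : ℝ) :
    Measurable (fun z => ENNReal.ofReal (Real.exp (-(m * fockWeight z)))) := by
  unfold fockWeight
  fun_prop

theorem integral_fockMeasure {E : Type*} [NormedAddCommGroup E] [NormedSpace ℝ E] (m : ℝ)
    (f : ℂ → E) :
    ∫ z, f z ∂(fockMeasure m) = Real.pi⁻¹ • ∫ z, Real.exp (-m * ‖z‖ ^ 2) • f z := by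
  rw [fockMeasure, weightedMeasure,
    integral_withDensity_eq_integral_toReal_smul (measurable_fockDensity m)
      (Eventually.of_forall fun _ => ENNReal.ofReal_lt_top), areaMeasure, integral_smul_measure,
    ENNReal.toReal_ofReal (by positivity)]
  simp only [ENNReal.toReal_ofReal (Real.exp_pos _).le, fockWeight, neg_mul]

theorem integral_fockMeasure_norm_pow (hm : 0 < m) (n : ℕ) :
    ∫ z : ℂ, ‖z‖ ^ n ∂(fockMeasure m) =
      m ^ (-((n : ℝ) + 2) / 2) * Real.Gamma (((n : ℝ) + 2) / 2) := by
  have h := Complex.integral_rpow_mul_exp_neg_mul_rpow (p := 2) (q := n) one_le_two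
    (by have : (0 : ℝ) ≤ n := Nat.cast_nonneg n; linarith) hm
  simp only [Real.rpow_natCast, Real.rpow_two] at h
  rw [integral_fockMeasure]
  simp only [smul_eq_mul]
  simp only [mul_comm (Real.exp _)]
  rw [h]
  field_simp

theorem integral_fockMeasure_norm_pow_even (hm : 0 < m) (n : ℕ) :
    ∫ z : ℂ, ‖z‖ ^ (2 * n) ∂(fockMeasure m) = n.factorial / m ^ (n + 1) := by
  rw [integral_fockMeasure_norm_pow hm]
  have h1 : (((2 * n : ℕ) : ℝ) + 2) / 2 = n + 1 := by push_cast; ring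
  rw [neg_div, h1, Real.Gamma_nat_eq_factorial, Real.rpow_neg hm.le]
  rw [show (n : ℝ) + 1 = ((n + 1 : ℕ) : ℝ) by push_cast; ring, Real.rpow_natCast]
  field_simp

theorem integrable_norm_pow (hm : 0 < m) (n : ℕ) :
    Integrable (fun z : ℂ => ‖z‖ ^ n) (fockMeasure m) := by
  -- A non-integrable function has integral `0` by convention, so the positive value given by the
  -- Gamma formula already proves integrability.
  refine Integrable.of_integral_ne_zero ?_
  rw [integral_fockMeasure_norm_pow hm]
  have h1 : 0 < Real.Gamma (((n : ℝ) + 2) / 2) := Real.Gamma_pos_of_pos (by positivity)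
  have h2 : 0 < m ^ (-((n : ℝ) + 2) / 2) := Real.rpow_pos_of_pos hm _
  positivity

theorem HasPolyGrowth.integrable {E : Type*} [NormedAddCommGroup E]
    (hm : 0 < m) {f : ℂ → E} (hf : HasPolyGrowth f)
    (hfm : AEStronglyMeasurable f (fockMeasure m)) : Integrable f (fockMeasure m) := by
  obtain ⟨C, d, h⟩ := hf
  have h1 : Integrable (fun z : ℂ => C * (1 + ‖z‖ ^ 2) ^ d) (fockMeasure m) := by
    refine Integrable.const_mul ?_ C
    simp only [add_comm (1 : ℝ), add_pow, one_pow, mul_one, ← pow_mul]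
    exact integrable_finsetSum _ fun i _ => (integrable_norm_pow hm _).mul_const _
  exact h1.mono' hfm (Eventually.of_forall h)

theorem integral_comp_rotation (m : ℝ) (u : Circle) (f : ℂ → ℂ) :
    ∫ z, f (u * z) ∂(fockMeasure m) = ∫ z, f z ∂(fockMeasure m) := by
  rw [integral_fockMeasure, integral_fockMeasure]
  congr 1
  have h := (rotation u).measurePreserving.integral_comp
    (rotation u).toHomeomorph.measurableEmbedding
    (fun z => Real.exp (-m * ‖z‖ ^ 2) • f z)
  simp only [rotation_apply, norm_mul, Circle.norm_coe, one_mul] at h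
  exact h

/-- The measure is rotation invariant, and rotation by `θ = π / (a - b)` multiplies the integrand by
`e^{iπ} = -1`. -/
theorem integral_pow_mul_conj_pow_of_ne (m : ℝ) {a b : ℕ} (hab : a ≠ b) :
    ∫ z : ℂ, z ^ a * (starRingEnd ℂ) z ^ b ∂(fockMeasure m) = 0 := by
  set θ : ℝ := Real.pi / ((a : ℝ) - b)
  have hab' : (a : ℝ) - b ≠ 0 := sub_ne_zero.2 (by exact_mod_cast hab)
  have h := integral_comp_rotation m (Circle.exp θ) (fun z => z ^ a * (starRingEnd ℂ) z ^ b)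
  have hu : (Circle.exp θ : ℂ) ^ a * (starRingEnd ℂ) (Circle.exp θ : ℂ) ^ b = -1 := by
    rw [Circle.coe_exp, ← Complex.exp_conj, ← Complex.exp_nat_mul, ← Complex.exp_nat_mul,
      ← Complex.exp_add, ← Complex.exp_pi_mul_I]
    congr 1
    simp only [map_mul, Complex.conj_ofReal, Complex.conj_I]
    have : ((a : ℂ) - b) * θ = Real.pi := by
      rw [← Complex.ofReal_natCast, ← Complex.ofReal_natCast, ← Complex.ofReal_sub,
        ← Complex.ofReal_mul, mul_div_cancel₀ _ hab']
    linear_combination Complex.I * this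
  have h2 : ∀ z : ℂ, ((Circle.exp θ : ℂ) * z) ^ a *
      (starRingEnd ℂ) ((Circle.exp θ : ℂ) * z) ^ b = -(z ^ a * (starRingEnd ℂ) z ^ b) := by
    intro z
    rw [map_mul, mul_pow, mul_pow]
    linear_combination (z ^ a * (starRingEnd ℂ) z ^ b) * hu
  simp only [h2] at h
  rw [integral_neg] at h
  linear_combination (-1 / 2 : ℂ) * h

theorem integral_pow_mul_conj_pow (hm : 0 < m) (a b : ℕ) :
    ∫ z : ℂ, z ^ a * (starRingEnd ℂ) z ^ b ∂(fockMeasure m) =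
      if a = b then ((a.factorial / m ^ (a + 1) : ℝ) : ℂ) else 0 := by
  split_ifs with h
  · subst h
    rw [← integral_fockMeasure_norm_pow_even hm, ← integral_complex_ofReal]
    congr 1
    ext z
    rw [← mul_pow, Complex.mul_conj, Complex.normSq_eq_norm_sq, pow_mul]
    push_cast; rfl
  · exact integral_pow_mul_conj_pow_of_ne m h

theorem integrable_eval_mul_conj_pow (hm : 0 < m) (u : Polynomial ℂ) (k : ℕ) :
    Integrable (fun z : ℂ => u.eval z * (starRingEnd ℂ) z ^ k) (fockMeasure m) := by
  refine HasPolyGrowth.integrable hm ?_ (Continuous.aestronglyMeasurable ?_)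
  · exact (hasPolyGrowth_eval u).mul
      ((hasPolyGrowth_id.of_norm_le fun z => by simp).pow k)
  · exact u.continuous.mul (Complex.continuous_conj.pow k)

theorem integral_eval_mul_conj_pow (hm : 0 < m) (u : Polynomial ℂ) (k : ℕ) :
    ∫ z : ℂ, u.eval z * (starRingEnd ℂ) z ^ k ∂(fockMeasure m) =
      u.coeff k * ((k.factorial / m ^ (k + 1) : ℝ) : ℂ) := by
  induction u using Polynomial.induction_on' with
  | add p q hp hq =>
    simp only [Polynomial.eval_add, add_mul, Polynomial.coeff_add]
    rw [integral_add (integrable_eval_mul_conj_pow hm p k) (integrable_eval_mul_conj_pow hm q k),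
      hp, hq]
  | monomial n a =>
    simp only [Polynomial.eval_monomial, Polynomial.coeff_monomial, mul_assoc]
    rw [integral_const_mul, integral_pow_mul_conj_pow hm]
    split_ifs with h
    · rw [h]
    · simp

/-- The reproducing kernel of the Bargmann-Fock weight. -/
def fockKernel (m : ℝ) (n : ℕ) (z w : ℂ) : ℂ :=
  ∑ k ∈ Finset.range n, ((m ^ (k + 1) / k.factorial : ℝ) : ℂ) * z ^ k * (starRingEnd ℂ) w ^ k

/-- `fockKernel` as a polynomial in the first variable. -/
def fockPoly (m : ℝ) (n : ℕ) (w : ℂ) : Polynomial ℂ :=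
  ∑ k ∈ Finset.range n,
    Polynomial.monomial k (((m ^ (k + 1) / k.factorial : ℝ) : ℂ) * (starRingEnd ℂ) w ^ k)

theorem eval_fockPoly (m : ℝ) (n : ℕ) (w z : ℂ) :
    (fockPoly m n w).eval z = fockKernel m n z w := by
  simp only [fockPoly, fockKernel, Polynomial.eval_finsetSum, Polynomial.eval_monomial]
  exact Finset.sum_congr rfl fun k _ => by ring

theorem coeff_fockPoly (m : ℝ) (n : ℕ) (w : ℂ) (k : ℕ) :
    (fockPoly m n w).coeff k =
      if k < n then ((m ^ (k + 1) / k.factorial : ℝ) : ℂ) * (starRingEnd ℂ) w ^ k else 0 := by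
  simp [fockPoly, Polynomial.coeff_monomial]

theorem conj_fockKernel (m : ℝ) (n : ℕ) (z w : ℂ) :
    (starRingEnd ℂ) (fockKernel m n z w) = fockKernel m n w z := by
  simp only [fockKernel, map_sum, map_mul, map_pow, Complex.conj_ofReal, Complex.conj_conj]
  exact Finset.sum_congr rfl fun k _ => by ring

/-- Integration against the kernel truncates a polynomial to degree less than `n`. -/
theorem integral_eval_mul_conj_fockKernel (hm : 0 < m) (n : ℕ) (u : Polynomial ℂ) (w : ℂ) :
    ∫ z, u.eval z * (starRingEnd ℂ) (fockKernel m n z w) ∂(fockMeasure m) =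
      ∑ k ∈ Finset.range n, u.coeff k * w ^ k := by
  have h1 : ∀ z, u.eval z * (starRingEnd ℂ) (fockKernel m n z w) =
      ∑ k ∈ Finset.range n, (((m ^ (k + 1) / k.factorial : ℝ) : ℂ) * w ^ k) *
        (u.eval z * (starRingEnd ℂ) z ^ k) := by
    intro z
    rw [conj_fockKernel, fockKernel, Finset.mul_sum]
    exact Finset.sum_congr rfl fun k _ => by ring
  simp only [h1]
  rw [integral_finsetSum _ fun k _ => (integrable_eval_mul_conj_pow hm u k).const_mul _]
  refine Finset.sum_congr rfl fun k _ => ?_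
  rw [integral_const_mul, integral_eval_mul_conj_pow hm]
  have h2 : ((m ^ (k + 1) / k.factorial : ℝ) : ℂ) * ((k.factorial / m ^ (k + 1) : ℝ) : ℂ) = 1 := by
    rw [← Complex.ofReal_mul, ← Complex.ofReal_one]
    congr 1
    field_simp
  linear_combination (w ^ k * u.coeff k) * h2

theorem isReproducingKernel_fockKernel (hm : 0 < m) (n : ℕ) :
    IsReproducingKernel (fockMeasure m) n (fockKernel m n) where
  mem w := by
    refine ⟨fockPoly m n w, ⟨?_, ?_⟩, fun z => (eval_fockPoly m n w z).symm⟩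
    · rw [Polynomial.mem_degreeLT, Polynomial.degree_lt_iff_coeff_zero]
      intro k hk
      rw [coeff_fockPoly, if_neg (not_lt.2 hk)]
    · have hc : Continuous (fun z => (fockPoly m n w).eval z) := (fockPoly m n w).continuous
      rw [memLp_two_iff_integrable_sq_norm hc.aestronglyMeasurable]
      refine HasPolyGrowth.integrable hm ?_ (hc.norm.pow 2).aestronglyMeasurable
      exact ((hasPolyGrowth_eval (fockPoly m n w)).of_norm_le
        (g := fun z => ‖(fockPoly m n w).eval z‖) fun z => by simp).pow 2
  reproducing u hu w := by
    rw [integral_eval_mul_conj_fockKernel hm]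
    have h := Polynomial.mem_degreeLT.1 hu.1
    rcases eq_or_ne u 0 with rfl | hu0
    · simp
    · exact Polynomial.eval_eq_sum_range' ((Polynomial.natDegree_lt_iff_degree_lt hu0).2 h) w

/-- Both sides evaluate the pairing of `K(·, w)` with `L(·, z)`. Taking `L = K` gives Hermitian
symmetry; comparing two kernels with a third expression of this kind gives uniqueness. -/
theorem IsReproducingKernel.eq_conj {μ : Measure ℂ} {n : ℕ} {K L : ℂ → ℂ → ℂ}
    (hK : IsReproducingKernel μ n K) (hL : IsReproducingKernel μ n L) (z w : ℂ) :
    K z w = (starRingEnd ℂ) (L w z) := by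
  obtain ⟨p, hp, hpK⟩ := hK.mem w
  obtain ⟨q, hq, hqL⟩ := hL.mem z
  rw [hpK, hqL, hL.reproducing p hp, hK.reproducing q hq, ← integral_conj]
  congr 1
  ext x
  rw [hpK, hqL, map_mul, Complex.conj_conj, mul_comm]

theorem reproducingKernel_eq {μ : Measure ℂ} {n : ℕ} {K : ℂ → ℂ → ℂ}
    (hK : IsReproducingKernel μ n K) : reproducingKernel μ n = K := by
  have h : ∃ K, IsReproducingKernel μ n K := ⟨K, hK⟩
  rw [reproducingKernel, dif_pos h]
  ext z w
  rw [h.choose_spec.eq_conj hK, ← hK.eq_conj hK]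

/-- The partial sums of the exponential series. -/
def expPartial (n : ℕ) (x : ℝ) : ℝ := ∑ k ∈ Finset.range n, x ^ k / k.factorial

theorem expPartial_pos {n : ℕ} (hn : 0 < n) {x : ℝ} (hx : 0 ≤ x) : 0 < expPartial n x := by
  obtain ⟨n, rfl⟩ := Nat.exists_eq_succ_of_ne_zero hn.ne'
  rw [expPartial, Finset.sum_range_succ']
  have : 0 ≤ ∑ k ∈ Finset.range n, x ^ (k + 1) / (k + 1).factorial :=
    Finset.sum_nonneg fun k _ => by positivity
  simp only [pow_zero, Nat.factorial_zero, Nat.cast_one]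
  linarith

theorem mul_conj_eq (w : ℂ) : w * (starRingEnd ℂ) w = ((‖w‖ ^ 2 : ℝ) : ℂ) := by
  rw [Complex.mul_conj, Complex.normSq_eq_norm_sq]

theorem fockKernel_self (m : ℝ) (n : ℕ) (w : ℂ) :
    fockKernel m n w w = ((m * expPartial n (m * ‖w‖ ^ 2) : ℝ) : ℂ) := by
  rw [fockKernel, expPartial, Finset.mul_sum, Complex.ofReal_sum]
  refine Finset.sum_congr rfl fun k _ => ?_
  rw [mul_assoc, ← mul_pow, mul_conj_eq, mul_pow]
  push_cast
  ring

/-- The Berezin measure of the Bargmann-Fock weight. -/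
abbrev fockBerezin (m : ℝ) (n : ℕ) (w : ℂ) : Measure ℂ := berezinMeasure fockWeight m n w

/-- The density of the Berezin measure with respect to `e^{-m|z|²} dA`. -/
def berezinDensity (m : ℝ) (n : ℕ) (w z : ℂ) : ℝ :=
  ‖fockKernel m n z w‖ ^ 2 / (m * expPartial n (m * ‖w‖ ^ 2))

theorem continuous_berezinDensity (m : ℝ) (n : ℕ) (w : ℂ) :
    Continuous (berezinDensity m n w) := by
  unfold berezinDensity
  simp only [← eval_fockPoly]
  exact ((fockPoly m n w).continuous.norm.pow 2).div_const _

theorem berezinDensity_nonneg (hm : 0 < m) (n : ℕ) (w z : ℂ) : 0 ≤ berezinDensity m n w z := by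
  have : 0 ≤ expPartial n (m * ‖w‖ ^ 2) := Finset.sum_nonneg fun k _ => by positivity
  unfold berezinDensity
  positivity

theorem hasPolyGrowth_berezinDensity (m : ℝ) (n : ℕ) (w : ℂ) :
    HasPolyGrowth (berezinDensity m n w) := by
  unfold berezinDensity
  simp only [← eval_fockPoly, div_eq_mul_inv]
  exact (((hasPolyGrowth_eval (fockPoly m n w)).of_norm_le
    (g := fun z => ‖(fockPoly m n w).eval z‖) fun z => by simp).pow 2).mul (hasPolyGrowth_const _)

theorem fockBerezin_eq (hm : 0 < m) (n : ℕ) (w : ℂ) :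
    fockBerezin m n w =
      (fockMeasure m).withDensity (fun z => ENNReal.ofReal (berezinDensity m n w z)) := by
  rw [fockBerezin, berezinMeasure, berezinMeasureOf,
    reproducingKernel_eq (isReproducingKernel_fockKernel hm n)]
  simp only [fockKernel_self, Complex.ofReal_re]
  rfl

theorem integral_fockBerezin {E : Type*} [NormedAddCommGroup E] [NormedSpace ℝ E] (hm : 0 < m)
    (n : ℕ) (w : ℂ) (f : ℂ → E) :
    ∫ z, f z ∂(fockBerezin m n w) = ∫ z, berezinDensity m n w z • f z ∂(fockMeasure m) := by
  rw [fockBerezin_eq hm, integral_withDensity_eq_integral_toReal_smul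
    (continuous_berezinDensity m n w).measurable.ennreal_ofReal
    (Eventually.of_forall fun _ => ENNReal.ofReal_lt_top)]
  simp only [ENNReal.toReal_ofReal (berezinDensity_nonneg hm n w _)]

/-- The total mass is `1` because the reproducing property applied to the kernel itself reads `∫
|K(z, w)|² = K(w, w)`. -/
theorem isProbabilityMeasure_fockBerezin (hm : 0 < m) {n : ℕ} (hn : 1 ≤ n) (w : ℂ) :
    IsProbabilityMeasure (fockBerezin m n w) := by
  have hE := expPartial_pos hn (x := m * ‖w‖ ^ 2) (by positivity)
  have hint : Integrable (berezinDensity m n w) (fockMeasure m) :=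
    (hasPolyGrowth_berezinDensity m n w).integrable hm
      (continuous_berezinDensity m n w).aestronglyMeasurable
  have h1 : ∫ z, berezinDensity m n w z ∂(fockMeasure m) = 1 := by
    have h := (isReproducingKernel_fockKernel hm n).reproducing (fockPoly m n w)
      (by
        obtain ⟨p, hp, hpK⟩ := (isReproducingKernel_fockKernel hm n).mem w
        have : p = fockPoly m n w := Polynomial.funext fun z => by rw [← hpK, eval_fockPoly]
        exact this ▸ hp) w
    simp only [eval_fockPoly, mul_conj_eq] at h
    rw [fockKernel_self, integral_complex_ofReal, Complex.ofReal_inj] at h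
    simp only [berezinDensity]
    rw [integral_div, ← h, div_self (by positivity)]
  constructor
  rw [fockBerezin_eq hm, withDensity_apply _ MeasurableSet.univ, Measure.restrict_univ,
    ← ofReal_integral_eq_lintegral_ofReal hint
      (Eventually.of_forall (berezinDensity_nonneg hm n w)), h1, ENNReal.ofReal_one]

theorem HasPolyGrowth.integrable_fockBerezin {E : Type*} [NormedAddCommGroup E] [NormedSpace ℝ E]
    (hm : 0 < m) {f : ℂ → E} (hf : HasPolyGrowth f) (hfc : Continuous f) (n : ℕ) (w : ℂ) :
    Integrable f (fockBerezin m n w) := by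
  rw [fockBerezin_eq hm, integrable_withDensity_iff_integrable_smul₀'
    (continuous_berezinDensity m n w).measurable.ennreal_ofReal.aemeasurable
    (Eventually.of_forall fun _ => ENNReal.ofReal_lt_top)]
  simp only [ENNReal.toReal_ofReal (berezinDensity_nonneg hm n w _)]
  refine HasPolyGrowth.integrable hm ?_
    ((continuous_berezinDensity m n w).smul hfc).aestronglyMeasurable
  exact ((hasPolyGrowth_berezinDensity m n w).mul (hf.of_norm_le (g := fun z => ‖f z‖)
    fun z => by simp)).of_norm_le fun z => by simp [norm_smul]

/-- The holomorphic moments of the Berezin measure. -/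
theorem integral_pow_fockBerezin (hm : 0 < m) {n : ℕ} (hn : 1 ≤ n) (w : ℂ) (j : ℕ) :
    ∫ z, z ^ j ∂(fockBerezin m n w) =
      w ^ j * ((expPartial (n - j) (m * ‖w‖ ^ 2) / expPartial n (m * ‖w‖ ^ 2) : ℝ) : ℂ) := by
  have hE := expPartial_pos hn (x := m * ‖w‖ ^ 2) (by positivity)
  rw [integral_fockBerezin hm]
  have h1 : ∀ z : ℂ, berezinDensity m n w z • z ^ j =
      (Polynomial.X ^ j * fockPoly m n w).eval z * (starRingEnd ℂ) (fockKernel m n z w) *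
        ((m * expPartial n (m * ‖w‖ ^ 2) : ℝ) : ℂ)⁻¹ := by
    intro z
    rw [Polynomial.eval_mul, Polynomial.eval_pow, Polynomial.eval_X, eval_fockPoly, mul_assoc (z ^ j),
      mul_conj_eq, berezinDensity, Complex.real_smul]
    push_cast
    ring
  simp only [h1]
  rw [integral_mul_const, integral_eval_mul_conj_fockKernel hm]
  -- Multiplication by `z^j` shifts coefficients up by `j`, and truncation at degree `n` leaves
  -- exactly the kernel terms of index below `n - j`. For `j ≥ n` the truncated subtraction gives
  -- the empty sum, as it should.
  have h2 : ∑ k ∈ Finset.range n, (Polynomial.X ^ j * fockPoly m n w).coeff k * w ^ k =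
      w ^ j * ((m * expPartial (n - j) (m * ‖w‖ ^ 2) : ℝ) : ℂ) := by
    rw [← fockKernel_self m (n - j) w, fockKernel, Finset.mul_sum]
    simp only [Polynomial.coeff_X_pow_mul', coeff_fockPoly]
    symm
    refine Finset.sum_of_injOn (fun k => k + j) (fun a _ b _ h => by simpa using h) ?_ ?_ ?_
    · intro k hk
      simp only [Finset.coe_range, Set.mem_Iio] at hk ⊢
      omega
    · intro k hk hk'
      rw [if_neg, zero_mul]
      intro hjk
      refine hk' ⟨k - j, ?_, by simp [hjk]⟩
      simp only [Finset.coe_range, Set.mem_Iio, Finset.mem_range] at hk ⊢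
      omega
    · intro k hk
      simp only [Finset.mem_range] at hk
      rw [if_pos (by omega), Nat.add_sub_cancel, if_pos (by omega), pow_add]
      ring
  rw [h2, mul_assoc, ← Complex.ofReal_inv, ← Complex.ofReal_mul]
  congr 2
  field_simp

/-- The radial moments of the Berezin measure. -/
theorem integral_norm_pow_fockBerezin (hm : 0 < m) {n : ℕ} (hn : 1 ≤ n) (w : ℂ) (i : ℕ) :
    ∫ z, ‖z‖ ^ (2 * i) ∂(fockBerezin m n w) =
      (∑ k ∈ Finset.range n, (m * ‖w‖ ^ 2) ^ k / k.factorial * ((k + 1).ascFactorial i : ℝ)) /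
        (m ^ i * expPartial n (m * ‖w‖ ^ 2)) := by
  have hE := expPartial_pos hn (x := m * ‖w‖ ^ 2) (by positivity)
  rw [integral_fockBerezin hm, ← Complex.ofReal_inj, ← integral_complex_ofReal]
  have h1 : ∀ z : ℂ, ((berezinDensity m n w z • ‖z‖ ^ (2 * i) : ℝ) : ℂ) =
      (∑ k ∈ Finset.range n, (((m ^ (k + 1) / k.factorial : ℝ) : ℂ) * w ^ k) *
        ((Polynomial.X ^ i * fockPoly m n w).eval z * (starRingEnd ℂ) z ^ (k + i))) *
        ((m * expPartial n (m * ‖w‖ ^ 2) : ℝ) : ℂ)⁻¹ := by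
    intro z
    -- Only the conjugate kernel factor is expanded: each term `conj z^(k+i)` then extracts one
    -- coefficient of `z^i K(z, w)`, and the ratio `(k+i)! / k!` of norms produces the ascending
    -- factorial.
    have h2 : ∑ k ∈ Finset.range n, (((m ^ (k + 1) / k.factorial : ℝ) : ℂ) * w ^ k) *
        ((Polynomial.X ^ i * fockPoly m n w).eval z * (starRingEnd ℂ) z ^ (k + i)) =
        (z * (starRingEnd ℂ) z) ^ i *
          (fockKernel m n z w * (starRingEnd ℂ) (fockKernel m n z w)) := by
      rw [conj_fockKernel, fockKernel.eq_def m n w z, Finset.mul_sum, Finset.mul_sum]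
      refine Finset.sum_congr rfl fun k _ => ?_
      rw [Polynomial.eval_mul, Polynomial.eval_pow, Polynomial.eval_X, eval_fockPoly, pow_add,
        mul_pow]
      ring
    rw [h2, mul_conj_eq, mul_conj_eq, berezinDensity, smul_eq_mul]
    push_cast
    ring
  simp only [h1]
  rw [integral_mul_const, integral_finsetSum _ fun k _ =>
    (integrable_eval_mul_conj_pow hm _ _).const_mul _]
  have h3 : ∀ k ∈ Finset.range n, (∫ z, (((m ^ (k + 1) / k.factorial : ℝ) : ℂ) * w ^ k) *
      ((Polynomial.X ^ i * fockPoly m n w).eval z * (starRingEnd ℂ) z ^ (k + i))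
        ∂(fockMeasure m)) =
      ((m / m ^ i * ((m * ‖w‖ ^ 2) ^ k / k.factorial * ((k + 1).ascFactorial i : ℝ)) : ℝ) : ℂ) := by
    intro k hk
    rw [integral_const_mul, integral_eval_mul_conj_pow hm, Polynomial.coeff_X_pow_mul,
      coeff_fockPoly, if_pos (Finset.mem_range.1 hk), ← Nat.factorial_mul_ascFactorial]
    have h4 : ((m ^ (k + 1) / k.factorial : ℝ) : ℂ) * w ^ k *
        (((m ^ (k + 1) / k.factorial : ℝ) : ℂ) * (starRingEnd ℂ) w ^ k *
          (((k.factorial * (k + 1).ascFactorial i : ℕ) / m ^ (k + i + 1) : ℝ) : ℂ)) =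
        (w * (starRingEnd ℂ) w) ^ k * ((m ^ (k + 1) / k.factorial * (m ^ (k + 1) / k.factorial *
          ((k.factorial * (k + 1).ascFactorial i : ℕ) / m ^ (k + i + 1))) : ℝ) : ℂ) := by
      rw [mul_pow]; push_cast; ring
    rw [h4, mul_conj_eq, ← Complex.ofReal_pow, ← Complex.ofReal_mul]
    congr 1
    push_cast
    field_simp
    ring
  rw [Finset.sum_congr rfl h3, ← Complex.ofReal_sum, ← Complex.ofReal_inv, ← Complex.ofReal_mul,
    ← Finset.mul_sum]
  congr 1
  field_simp

end Moments

/-! ### Ratios of truncated exponential sums. -/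

/-- The sum telescopes, since `(x - k) x^k/k! = (k+1) x^(k+1)/(k+1)! - k x^k/k!`. -/
theorem sum_sub_mul_pow_div_factorial (n : ℕ) (x : ℝ) :
    ∑ k ∈ Finset.range n, (x - k) * (x ^ k / k.factorial) = n * (x ^ n / n.factorial) := by
  induction n with
  | zero => simp
  | succ n ih =>
    rw [Finset.sum_range_succ, ih, Nat.factorial_succ, pow_succ]
    push_cast
    field_simp
    ring

/-- Summation by parts: passing from `n` to `n + 1` adds the preceding telescoped sum. -/
theorem sum_sub_mul_sub_mul_pow_div_factorial (n : ℕ) (x : ℝ) :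
    ∑ k ∈ Finset.range n, (n - k) * ((x - k) * (x ^ k / k.factorial)) = x * expPartial n x := by
  induction n with
  | zero => simp [expPartial]
  | succ n ih =>
    have h1 : ∀ k : ℕ, (((n + 1 : ℕ) : ℝ) - k) * ((x - k) * (x ^ k / k.factorial)) =
        (n - k) * ((x - k) * (x ^ k / k.factorial)) + (x - k) * (x ^ k / k.factorial) := by
      intro k; push_cast; ring
    simp only [h1]
    rw [Finset.sum_add_distrib, Finset.sum_range_succ, ih, sum_sub_mul_pow_div_factorial,
      expPartial, expPartial, Finset.sum_range_succ, Nat.factorial_succ, pow_succ]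
    push_cast
    field_simp
    ring

theorem expPartial_succ (n : ℕ) (x : ℝ) :
    expPartial (n + 1) x = expPartial n x + x ^ n / n.factorial :=
  Finset.sum_range_succ _ _

/-- With `x^k/k!` as weights on `k ≤ n`, the mean index is `x E_n / E_{n+1}`. Bounding the ratio of
consecutive partial sums thus means locating this mean. -/
theorem sum_natCast_mul_pow_div_factorial (n : ℕ) (x : ℝ) :
    ∑ k ∈ Finset.range (n + 1), k * (x ^ k / k.factorial) = x * expPartial n x := by
  have h := sum_sub_mul_pow_div_factorial (n + 1) x
  simp only [sub_mul, Finset.sum_sub_distrib, ← Finset.mul_sum] at h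
  have h1 : ((n + 1 : ℕ) : ℝ) * (x ^ (n + 1) / (n + 1).factorial) = x * (x ^ n / n.factorial) := by
    rw [Nat.factorial_succ, pow_succ]
    push_cast
    field_simp
  rw [← expPartial, expPartial_succ, h1] at h
  linarith

theorem expPartial_ratio_le {n : ℕ} {x : ℝ} (hx : 0 < x) :
    expPartial n x / expPartial (n + 1) x ≤ (n + 1 : ℕ) / x := by
  rw [div_le_div_iff₀ (expPartial_pos n.succ_pos hx.le) hx, mul_comm _ x,
    ← sum_natCast_mul_pow_div_factorial, expPartial, Finset.mul_sum]
  refine Finset.sum_le_sum fun k hk => ?_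
  have : (k : ℝ) ≤ (n + 1 : ℕ) := by exact_mod_cast (Finset.mem_range.1 hk).le
  gcongr

/-- With `N = n + 1 < x`, the mean of `N - k` is small because the weights pile up near `k = N`:
replacing `x - k` by the smaller `x - N` in the second-order identity bounds that mean by `x / (x -
N)`. -/
theorem le_expPartial_ratio {n : ℕ} {x : ℝ} (hx : ((n + 1 : ℕ) : ℝ) < x) :
    (n + 1 : ℕ) / x - 1 / (x - (n + 1 : ℕ)) ≤ expPartial n x / expPartial (n + 1) x := by
  have hx0 : 0 < x := lt_of_le_of_lt (Nat.cast_nonneg _) hx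
  have hE := expPartial_pos n.succ_pos hx0.le
  have hd : 0 < x - (n + 1 : ℕ) := by linarith
  set N : ℝ := ((n + 1 : ℕ) : ℝ) with hN
  have h1 : (x - N) * ∑ k ∈ Finset.range (n + 1), (N - k) * (x ^ k / k.factorial) ≤
      x * expPartial (n + 1) x := by
    rw [← sum_sub_mul_sub_mul_pow_div_factorial, Finset.mul_sum]
    refine Finset.sum_le_sum fun k hk => ?_
    have hk' : (k : ℝ) ≤ N := by rw [hN]; exact_mod_cast (Finset.mem_range.1 hk).le
    have hp : 0 ≤ (N - k) * (x ^ k / k.factorial) :=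
      mul_nonneg (by linarith) (by positivity)
    calc (x - N) * ((N - k) * (x ^ k / k.factorial))
        ≤ (x - k) * ((N - k) * (x ^ k / k.factorial)) := by gcongr
      _ = _ := by ring
  have h2 : ∑ k ∈ Finset.range (n + 1), (N - k) * (x ^ k / k.factorial) =
      N * expPartial (n + 1) x - x * expPartial n x := by
    simp only [sub_mul, Finset.sum_sub_distrib, ← Finset.mul_sum]
    rw [sum_natCast_mul_pow_div_factorial, ← expPartial]
  rw [h2] at h1
  rw [sub_le_iff_le_add, ← sub_le_iff_le_add', div_sub_div _ _ hx0.ne' hE.ne',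
    div_le_div_iff₀ (by positivity) hd]
  linarith

section Limits

variable {ι : Type*} {l : Filter ι} {m : ι → ℝ} {n : ι → ℕ} {τ s : ℝ}

theorem tendsto_natSub_div (hm : Tendsto m l atTop) (hn : Tendsto (fun i => (n i : ℝ) / m i) l (𝓝 τ))
    (hτ : 0 < τ) (j : ℕ) : Tendsto (fun i => ((n i - j : ℕ) : ℝ) / m i) l (𝓝 τ) := by
  have hn' : Tendsto (fun i => (n i : ℝ)) l atTop := by
    refine (hn.pos_mul_atTop hτ hm).congr' ?_
    filter_upwards [hm.eventually_gt_atTop 0] with i hi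
    field_simp
  have h : Tendsto (fun i => (n i : ℝ) / m i - j / m i) l (𝓝 (τ - 0)) :=
    hn.sub (tendsto_const_nhds.div_atTop hm)
  rw [sub_zero] at h
  refine h.congr' ?_
  filter_upwards [hn'.eventually_ge_atTop (j : ℝ)] with i hi
  rw [Nat.cast_sub (by exact_mod_cast hi), sub_div]

/-- Here `s` plays the role of `|z₀|²`, and `τ < s` is decisive: the error `1 / (ms - n)` vanishes
because `ms - n = m (s - n/m)` tends to infinity. -/
theorem tendsto_expPartial_pred_ratio (hm : Tendsto m l atTop)
    (hn : Tendsto (fun i => (n i : ℝ) / m i) l (𝓝 τ)) (hτ : 0 < τ) (hs : τ < s) :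
    Tendsto (fun i => expPartial (n i - 1) (m i * s) / expPartial (n i) (m i * s)) l
      (𝓝 (τ / s)) := by
  have hs0 : 0 < s := hτ.trans hs
  have hup : Tendsto (fun i => (n i : ℝ) / (m i * s)) l (𝓝 (τ / s)) := by
    simpa only [div_div] using hn.div_const s
  have hlow : Tendsto (fun i => (n i : ℝ) / (m i * s) - 1 / (m i * s - n i)) l
      (𝓝 (τ / s - 0)) := by
    refine hup.sub (tendsto_const_nhds.div_atTop ?_)
    have h1 : Tendsto (fun i => (s - n i / m i) * m i) l atTop :=
      (tendsto_const_nhds.sub hn).pos_mul_atTop (by linarith) hm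
    refine h1.congr' ?_
    filter_upwards [hm.eventually_gt_atTop 0] with i hi
    field_simp
  rw [sub_zero] at hlow
  have hpos : ∀ᶠ i in l, 0 < n i ∧ (n i : ℝ) < m i * s ∧ 0 < m i := by
    filter_upwards [hm.eventually_gt_atTop 0, hn.eventually_lt_const hs,
      hn.eventually_const_lt hτ] with i h1 h2 h3
    refine ⟨?_, ?_, h1⟩
    · rcases Nat.eq_zero_or_pos (n i) with h | h
      · simp [h] at h3
      · exact h
    · rw [div_lt_iff₀ h1] at h2; linarith
  refine tendsto_of_tendsto_of_tendsto_of_le_of_le' hlow hup ?_ ?_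
  · filter_upwards [hpos] with i ⟨h1, h2, _⟩
    obtain ⟨k, hk⟩ := Nat.exists_eq_succ_of_ne_zero h1.ne'
    rw [hk] at h2 ⊢
    exact le_expPartial_ratio h2
  · filter_upwards [hpos] with i ⟨h1, _, h3⟩
    obtain ⟨k, hk⟩ := Nat.exists_eq_succ_of_ne_zero h1.ne'
    rw [hk]
    exact expPartial_ratio_le (by positivity)

theorem tendsto_expPartial_ratio (hm : Tendsto m l atTop)
    (hn : Tendsto (fun i => (n i : ℝ) / m i) l (𝓝 τ)) (hτ : 0 < τ) (hs : τ < s) (j : ℕ) :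
    Tendsto (fun i => expPartial (n i - j) (m i * s) / expPartial (n i) (m i * s)) l
      (𝓝 ((τ / s) ^ j)) := by
  have hs0 : 0 < s := hτ.trans hs
  induction j with
  | zero =>
    simp only [Nat.sub_zero, pow_zero]
    refine tendsto_const_nhds.congr' ?_
    filter_upwards [hm.eventually_gt_atTop 0, hn.eventually_const_lt hτ] with i h1 h3
    have h : 0 < n i := Nat.pos_of_ne_zero fun h => by simp [h] at h3
    rw [div_self (expPartial_pos h (by positivity)).ne']
  | succ j ih =>
    have h := (tendsto_expPartial_pred_ratio hm (tendsto_natSub_div hm hn hτ j) hτ hs).mul ih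
    rw [pow_succ']
    refine h.congr' ?_
    filter_upwards [hm.eventually_gt_atTop 0,
      (tendsto_natSub_div hm hn hτ j).eventually_const_lt hτ] with i h1 h3
    have h : 0 < n i - j := Nat.pos_of_ne_zero fun h => by simp [h] at h3
    rw [div_mul_div_cancel₀ (expPartial_pos h (by positivity)).ne', Nat.sub_sub]

theorem sum_descFactorial_mul (n i : ℕ) (x : ℝ) :
    ∑ k ∈ Finset.range n, x ^ k / k.factorial * (k.descFactorial i : ℝ) =
      x ^ i * expPartial (n - i) x := by
  rw [expPartial, Finset.mul_sum]
  symm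
  refine Finset.sum_of_injOn (fun k => k + i) (fun a _ b _ h => by simpa using h) ?_ ?_ ?_
  · intro k hk
    simp only [Finset.coe_range, Set.mem_Iio] at hk ⊢
    omega
  · intro k hk hk'
    rw [Nat.descFactorial_eq_zero_iff_lt.2, Nat.cast_zero, mul_zero]
    by_contra! hik
    refine hk' ⟨k - i, ?_, by simp [hik]⟩
    simp only [Finset.coe_range, Set.mem_Iio, Finset.mem_range] at hk ⊢
    omega
  · intro k _
    have h := Nat.factorial_mul_descFactorial (Nat.le_add_left i k)
    rw [Nat.add_sub_cancel] at h
    rw [← h, pow_add]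
    have : ((k + i).descFactorial i : ℝ) ≠ 0 := by
      exact_mod_cast (Nat.descFactorial_pos.2 (Nat.le_add_left i k)).ne'
    push_cast
    field_simp

/-- The ascending factorial lies between the descending factorial of `k`, whose weighted sum is `x^j
E_{n-j}(x)`, and `(n + j)^j`. After normalization both bounds tend to `τ^j`. -/
theorem tendsto_radialMoment (hm : Tendsto m l atTop)
    (hn : Tendsto (fun i => (n i : ℝ) / m i) l (𝓝 τ)) (hτ : 0 < τ) (hs : τ < s) (j : ℕ) :
    Tendsto (fun i => (∑ k ∈ Finset.range (n i), (m i * s) ^ k / k.factorial *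
        ((k + 1).ascFactorial j : ℝ)) / (m i ^ j * expPartial (n i) (m i * s))) l
      (𝓝 (τ ^ j)) := by
  have hs0 : 0 < s := hτ.trans hs
  have hlow : Tendsto (fun i => s ^ j * (expPartial (n i - j) (m i * s) /
      expPartial (n i) (m i * s))) l (𝓝 (τ ^ j)) := by
    have h := (tendsto_expPartial_ratio hm hn hτ hs j).const_mul (s ^ j)
    rwa [← mul_pow, mul_div_cancel₀ _ hs0.ne'] at h
  have hup : Tendsto (fun i => ((n i : ℝ) / m i + j / m i) ^ j) l (𝓝 ((τ + 0) ^ j)) :=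
    (hn.add (tendsto_const_nhds.div_atTop hm)).pow j
  rw [add_zero] at hup
  have hpos : ∀ᶠ i in l, 0 < n i ∧ 0 < m i := by
    filter_upwards [hm.eventually_gt_atTop 0, hn.eventually_const_lt hτ] with i h1 h3
    exact ⟨Nat.pos_of_ne_zero fun h => by simp [h] at h3, h1⟩
  refine tendsto_of_tendsto_of_tendsto_of_le_of_le' hlow hup ?_ ?_
  · filter_upwards [hpos] with i ⟨h1, h2⟩
    have hE := expPartial_pos h1 (x := m i * s) (by positivity)
    rw [← mul_div_assoc, div_le_div_iff₀ hE (by positivity)]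
    have h := Finset.sum_le_sum (s := Finset.range (n i))
      (f := fun k => (m i * s) ^ k / k.factorial * (k.descFactorial j : ℝ))
      (g := fun k => (m i * s) ^ k / k.factorial * ((k + 1).ascFactorial j : ℝ)) fun k _ => by
        have : (k.descFactorial j : ℝ) ≤ (k + 1).ascFactorial j := by
          exact_mod_cast (Nat.descFactorial_le_pow k j).trans
            ((Nat.pow_le_pow_left k.le_succ j).trans (Nat.pow_succ_le_ascFactorial (k + 1) j))
        have h0 : 0 ≤ m i * s := by positivity
        gcongr
    rw [sum_descFactorial_mul] at h
    calc s ^ j * expPartial (n i - j) (m i * s) * (m i ^ j * expPartial (n i) (m i * s))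
        = (m i * s) ^ j * expPartial (n i - j) (m i * s) * expPartial (n i) (m i * s) := by ring
      _ ≤ _ := by gcongr
  · filter_upwards [hpos] with i ⟨h1, h2⟩
    have hE := expPartial_pos h1 (x := m i * s) (by positivity)
    rw [← add_div, div_pow, div_le_div_iff₀ (by positivity) (by positivity)]
    have h : ∑ k ∈ Finset.range (n i), (m i * s) ^ k / k.factorial *
        ((k + 1).ascFactorial j : ℝ) ≤ (n i + j : ℝ) ^ j * expPartial (n i) (m i * s) := by
      rw [expPartial, Finset.mul_sum]
      refine Finset.sum_le_sum fun k hk => ?_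
      rw [mul_comm]
      have : ((k + 1).ascFactorial j : ℝ) ≤ (n i + j : ℝ) ^ j := by
        exact_mod_cast (Nat.ascFactorial_le_pow_add k j).trans
          (Nat.pow_le_pow_left (Nat.add_le_add_right (Finset.mem_range.1 hk).le j) j)
      have h0 : 0 ≤ m i * s := by positivity
      gcongr
    calc _ ≤ (n i + j : ℝ) ^ j * expPartial (n i) (m i * s) * m i ^ j := by gcongr
      _ = _ := by ring

end Limits

/-! ### Polynomial approximation on a circle and the Poisson integral in a disc. -/

/-- With `z = ρ e^{iθ}`, the character `e^{ikθ}` is `(z/ρ)^k` for `k ≥ 0` and the conjugate of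
`(z/ρ)^|k|` for `k < 0`. -/
theorem exists_eval_add_conj_eval (ρ : ℝ) (hρ : 0 < ρ) {f : C(AddCircle (2 * Real.pi), ℂ)}
    (hf : f ∈ Submodule.span ℂ (Set.range <| @fourier (2 * Real.pi))) :
    ∃ p q : Polynomial ℂ, ∀ θ : AddCircle (2 * Real.pi),
      f θ = p.eval (ρ * (AddCircle.toCircle θ : ℂ)) +
        (starRingEnd ℂ) (q.eval (ρ * (AddCircle.toCircle θ : ℂ))) := by
  have hρ' : (ρ : ℂ) ≠ 0 := by exact_mod_cast hρ.ne'
  induction hf using Submodule.span_induction with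
  | mem f hf =>
    obtain ⟨k, rfl⟩ := hf
    rcases Int.natAbs_eq k with hk | hk
    · refine ⟨Polynomial.monomial k.natAbs ((ρ : ℂ)⁻¹ ^ k.natAbs), 0, fun θ => ?_⟩
      rw [fourier_apply, AddCircle.toCircle_zsmul, Polynomial.eval_monomial, ← mul_pow,
        inv_mul_cancel_left₀ hρ', Polynomial.eval_zero, map_zero, add_zero]
      conv_lhs => rw [hk]
      rw [zpow_natCast, Circle.coe_pow]
    · refine ⟨0, Polynomial.monomial k.natAbs ((ρ : ℂ)⁻¹ ^ k.natAbs), fun θ => ?_⟩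
      rw [fourier_apply, AddCircle.toCircle_zsmul, Polynomial.eval_monomial, ← mul_pow,
        inv_mul_cancel_left₀ hρ', Polynomial.eval_zero, zero_add]
      conv_lhs => rw [hk]
      rw [zpow_neg, zpow_natCast, Circle.coe_inv_eq_conj]
      simp
  | zero => exact ⟨0, 0, fun θ => by simp⟩
  | add f g _ _ hf hg =>
    obtain ⟨p, q, h⟩ := hf
    obtain ⟨p', q', h'⟩ := hg
    refine ⟨p + p', q + q', fun θ => ?_⟩
    rw [ContinuousMap.add_apply, h, h', Polynomial.eval_add, Polynomial.eval_add, map_add]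
    ring
  | smul a f _ hf =>
    obtain ⟨p, q, h⟩ := hf
    refine ⟨Polynomial.C a * p, Polynomial.C ((starRingEnd ℂ) a) * q, fun θ => ?_⟩
    rw [ContinuousMap.smul_apply, h, Polynomial.eval_mul, Polynomial.eval_mul, map_mul]
    simp only [Polynomial.eval_C, Complex.conj_conj, smul_eq_mul]
    ring

/-- Real parts of polynomials are dense in the continuous functions on a circle. -/
theorem exists_re_eval_approx {ρ : ℝ} (hρ : 0 < ρ) {g : ℂ → ℝ} (hg : ContinuousOn g (sphere 0 ρ))
    {ε : ℝ} (hε : 0 < ε) :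
    ∃ p : Polynomial ℂ, ∀ z ∈ sphere (0 : ℂ) ρ, |g z - (p.eval z).re| < ε := by
  have : Fact (0 < 2 * Real.pi) := ⟨Real.two_pi_pos⟩
  have hmem : ∀ θ : AddCircle (2 * Real.pi),
      (ρ : ℂ) * (AddCircle.toCircle θ : ℂ) ∈ sphere (0 : ℂ) ρ := fun θ => by
    rw [mem_sphere_zero_iff_norm, norm_mul, Circle.norm_coe, mul_one, Complex.norm_real,
      Real.norm_of_nonneg hρ.le]
  let G : C(AddCircle (2 * Real.pi), ℂ) :=
    ⟨fun θ => (g ((ρ : ℂ) * (AddCircle.toCircle θ : ℂ)) : ℂ), by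
      refine Complex.continuous_ofReal.comp (hg.comp_continuous ?_ hmem)
      exact continuous_const.mul (continuous_induced_dom.comp AddCircle.continuous_toCircle)⟩
  have hG : G ∈ (Submodule.span ℂ (Set.range <| @fourier (2 * Real.pi))).topologicalClosure := by
    rw [span_fourier_closure_eq_top]; trivial
  rw [← SetLike.mem_coe, Submodule.topologicalClosure_coe, Metric.mem_closure_iff] at hG
  obtain ⟨f, hf, hdist⟩ := hG ε hε
  obtain ⟨p, q, hpq⟩ := exists_eval_add_conj_eval ρ hρ hf
  -- The target function is real, so only `Re (p + conj q)` matters, and this equals `Re (p + q)`.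
  refine ⟨p + q, fun z hz => ?_⟩
  have hz' : (ρ : ℂ) * (AddCircle.toCircle (z.arg : AddCircle (2 * Real.pi)) : ℂ) = z := by
    rw [AddCircle.toCircle_apply_mk, div_self Real.two_pi_pos.ne', one_mul, Circle.coe_exp]
    rw [mem_sphere_zero_iff_norm] at hz
    rw [← hz, Complex.norm_mul_exp_arg_mul_I]
  have h := (ContinuousMap.dist_apply_le_dist (f := G) (g := f)
    (z.arg : AddCircle (2 * Real.pi))).trans_lt hdist
  rw [hpq, dist_eq_norm] at h
  simp only [G, ContinuousMap.coe_mk, hz'] at h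
  refine lt_of_le_of_lt ?_ h
  refine le_trans (le_of_eq ?_) (Complex.abs_re_le_norm _)
  simp [Polynomial.eval_add]

theorem continuousOn_poissonKernel_sphere {ρ : ℝ} {w : ℂ} (hw : w ∈ ball (0 : ℂ) ρ) :
    ContinuousOn (poissonKernel 0 w) (sphere 0 |ρ|) := by
  rw [poissonKernel_eq_re_herglotzRieszKernel]
  exact Complex.continuous_re.comp_continuousOn (continuousOn_herglotzRieszKernel_sphere hw)

theorem poissonKernel_nonneg {ρ : ℝ} {w z : ℂ} (hw : w ∈ ball (0 : ℂ) ρ)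
    (hz : z ∈ sphere (0 : ℂ) |ρ|) : 0 ≤ poissonKernel 0 w z := by
  have hρ := pos_of_mem_ball hw
  rw [mem_ball_zero_iff] at hw
  rw [mem_sphere_zero_iff_norm, abs_of_pos hρ] at hz
  rw [poissonKernel_def, sub_zero, sub_zero, hz]
  have : ‖w‖ ^ 2 ≤ ρ ^ 2 := pow_le_pow_left₀ (norm_nonneg _) hw.le 2
  exact div_nonneg (by linarith) (by positivity)

theorem harmonicOnNhd_re_eval (p : Polynomial ℂ) (s : Set ℂ) :
    InnerProductSpace.HarmonicOnNhd (fun z => (p.eval z).re) s := fun z _ =>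
  AnalyticAt.harmonicAt_re (f := fun z => p.eval z) (p.differentiable.analyticAt z)

theorem circleAverage_poissonKernel_smul_le {ρ : ℝ} {w : ℂ} (hw : w ∈ ball (0 : ℂ) ρ)
    {f g : ℂ → ℝ} (hf : ContinuousOn f (sphere 0 ρ)) (hg : ContinuousOn g (sphere 0 ρ))
    (hfg : ∀ z ∈ sphere (0 : ℂ) ρ, f z ≤ g z) :
    Real.circleAverage (poissonKernel 0 w • f) 0 ρ ≤
      Real.circleAverage (poissonKernel 0 w • g) 0 ρ := by
  have hρ := abs_of_pos (pos_of_mem_ball hw)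
  refine Real.circleAverage_mono
    ((continuousOn_poissonKernel_sphere hw).smul (hρ.symm ▸ hf)).circleIntegrable'
    ((continuousOn_poissonKernel_sphere hw).smul (hρ.symm ▸ hg)).circleIntegrable' fun z hz => ?_
  exact mul_le_mul_of_nonneg_left (hfg z (hρ ▸ hz)) (poissonKernel_nonneg hw hz)

theorem circleAverage_poissonKernel_smul_re_eval_add {ρ : ℝ} {w : ℂ} (hw : w ∈ ball (0 : ℂ) ρ)
    (p : Polynomial ℂ) (a : ℝ) :
    Real.circleAverage (poissonKernel 0 w • fun z => (p.eval z).re + a) 0 ρ =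
      (p.eval w).re + a := by
  have h := (harmonicOnNhd_re_eval (p + Polynomial.C (a : ℂ))
    (closedBall 0 ρ)).circleAverage_poissonKernel_smul hw
  simpa using h

open Classical in
/-- The Poisson integral of `g` in the disc of radius `ρ`, extended by `g`. -/
def poissonExtension (ρ : ℝ) (g : ℂ → ℝ) (w : ℂ) : ℝ :=
  if w ∈ ball (0 : ℂ) ρ then Real.circleAverage (poissonKernel 0 w • g) 0 ρ else g w

theorem harmonicOnNhd_poissonExtension {ρ : ℝ} (hρ : 0 < ρ) {g : ℂ → ℝ}
    (hg : ContinuousOn g (sphere 0 ρ)) :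
    InnerProductSpace.HarmonicOnNhd (poissonExtension ρ g) (ball 0 ρ) := by
  intro w hw
  have hgi : CircleIntegrable g 0 ρ := hg.circleIntegrable hρ.le
  have hgi' : CircleIntegrable (fun ζ => (g ζ : ℂ)) 0 ρ :=
    (Complex.continuous_ofReal.comp_continuousOn hg).circleIntegrable hρ.le
  have h1 := (analyticOnNhd_circleAverage_herglotzRieszKernel_smul hgi' w hw).harmonicAt_re
  refine (InnerProductSpace.harmonicAt_congr_nhds ?_).1 h1
  filter_upwards [isOpen_ball.mem_nhds hw] with v hv
  rw [re_circleAverage_herglotzRieszKernel_smul hgi hv, poissonExtension, if_pos hv,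
    poissonKernel_eq_re_herglotzRieszKernel]

/-- The Poisson integral reproduces `Re p` and is monotone, so approximating `g` by `Re p` on the
circle approximates the extension equally well on the closed disc. The extension is a uniform limit
of continuous functions. -/
theorem continuousOn_poissonExtension {ρ : ℝ} (hρ : 0 < ρ) {g : ℂ → ℝ}
    (hg : ContinuousOn g (sphere 0 ρ)) : ContinuousOn (poissonExtension ρ g) (closedBall 0 ρ) := by
  refine continuousOn_of_uniform_approx_of_continuousOn fun u hu => ?_
  obtain ⟨ε, hε, hεu⟩ := Metric.mem_uniformity_dist.1 hu
  obtain ⟨p, hp⟩ := exists_re_eval_approx hρ hg (half_pos hε)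
  refine ⟨fun z => (p.eval z).re, (Complex.continuous_re.comp p.continuous).continuousOn,
    fun w hw => hεu ?_⟩
  rw [Real.dist_eq]
  by_cases hwb : w ∈ ball (0 : ℂ) ρ
  · rw [poissonExtension, if_pos hwb]
    have hc : ∀ a : ℝ, ContinuousOn (fun z => (p.eval z).re + a) (sphere 0 ρ) := fun a =>
      ((Complex.continuous_re.comp p.continuous).add continuous_const).continuousOn
    have h1 := circleAverage_poissonKernel_smul_le hwb hg (hc (ε / 2)) fun z hz => by
      linarith [(abs_lt.1 (hp z hz)).2]
    have h2 := circleAverage_poissonKernel_smul_le hwb (hc (-(ε / 2))) hg fun z hz => by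
      linarith [(abs_lt.1 (hp z hz)).1]
    rw [circleAverage_poissonKernel_smul_re_eval_add hwb] at h1 h2
    rw [abs_lt]
    constructor <;> linarith
  · rw [poissonExtension, if_neg hwb]
    refine (hp w ?_).trans (half_lt_self hε)
    rw [mem_sphere]
    exact le_antisymm hw (not_lt.1 hwb)

theorem poissonExtension_of_mem_sphere {ρ : ℝ} {g : ℂ → ℝ} {w : ℂ} (hw : w ∈ sphere (0 : ℂ) ρ) :
    poissonExtension ρ g w = g w := by
  rw [poissonExtension, if_neg]
  rw [mem_ball, mem_sphere.1 hw]
  exact lt_irrefl ρ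

/-! ### The Dirichlet problem and harmonic measure outside a disc. -/

section Sphere

variable {R : ℝ}

theorem coe_preimage_sphereCompl (S : Set ℂ) :
    ((↑) : ℂ → OnePoint ℂ) ⁻¹' (sphereCompl S) = Sᶜ := by
  ext z; simp [sphereCompl]

theorem infty_mem_sphereCompl (S : Set ℂ) : OnePoint.infty ∈ sphereCompl S := by
  simp [sphereCompl]

theorem coe_mem_sphereCompl_closedBall {z : ℂ} :
    (z : OnePoint ℂ) ∈ sphereCompl (closedBall 0 R) ↔ R < ‖z‖ := by
  rw [← Set.mem_preimage, coe_preimage_sphereCompl]; simp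

theorem coe_mem_closure_sphereCompl (hR : 0 < R) {z : ℂ} :
    (z : OnePoint ℂ) ∈ closure (sphereCompl (closedBall 0 R)) ↔ R ≤ ‖z‖ := by
  rw [← Set.mem_preimage, OnePoint.isOpenEmbedding_coe.isOpenMap.preimage_closure_eq_closure_preimage
    OnePoint.continuous_coe, coe_preimage_sphereCompl, closure_compl,
    interior_closedBall _ hR.ne']
  simp

theorem coe_mem_frontier_sphereCompl (hR : 0 < R) {z : ℂ} :
    (z : OnePoint ℂ) ∈ frontier (sphereCompl (closedBall 0 R)) ↔ ‖z‖ = R := by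
  rw [← Set.mem_preimage, OnePoint.isOpenEmbedding_coe.isOpenMap.preimage_frontier_eq_frontier_preimage
    OnePoint.continuous_coe, coe_preimage_sphereCompl, frontier_compl,
    frontier_closedBall _ hR.ne']
  simp

theorem isOpen_sphereCompl_closedBall (R : ℝ) : IsOpen (sphereCompl (closedBall 0 R)) :=
  (((isCompact_closedBall 0 R).image OnePoint.continuous_coe).isClosed).isOpen_compl

theorem infty_notMem_frontier_sphereCompl (R : ℝ) :
    OnePoint.infty ∉ frontier (sphereCompl (closedBall 0 R)) := fun h => by
  rw [(isOpen_sphereCompl_closedBall R).frontier_eq] at h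
  exact h.2 (infty_mem_sphereCompl _)

theorem chartAtInfty_of_ne {w : ℂ} (hw : w ≠ 0) : chartAtInfty w = ((w⁻¹ : ℂ) : OnePoint ℂ) :=
  if_neg hw

theorem chartAtInfty_zero : chartAtInfty 0 = OnePoint.infty := if_pos rfl

theorem chartAtInfty_mem_sphereCompl (hR : 0 < R) {w : ℂ} :
    chartAtInfty w ∈ sphereCompl (closedBall 0 R) ↔ w ∈ ball (0 : ℂ) R⁻¹ := by
  rcases eq_or_ne w 0 with rfl | hw
  · simp [chartAtInfty_zero, infty_mem_sphereCompl, hR]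
  · rw [chartAtInfty_of_ne hw, coe_mem_sphereCompl_closedBall, mem_ball_zero_iff, norm_inv,
      lt_inv_comm₀ hR (norm_pos_iff.2 hw)]

theorem chartAtInfty_mem_closure_sphereCompl (hR : 0 < R) {w : ℂ} :
    chartAtInfty w ∈ closure (sphereCompl (closedBall 0 R)) ↔ w ∈ closedBall (0 : ℂ) R⁻¹ := by
  rcases eq_or_ne w 0 with rfl | hw
  · simp [chartAtInfty_zero, subset_closure (infty_mem_sphereCompl _), hR.le]
  · rw [chartAtInfty_of_ne hw, coe_mem_closure_sphereCompl hR, mem_closedBall_zero_iff, norm_inv,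
      le_inv_comm₀ hR (norm_pos_iff.2 hw)]

theorem continuous_chartAtInfty : Continuous chartAtInfty := by
  refine continuous_iff_continuousAt.2 fun w => ?_
  rcases eq_or_ne w 0 with rfl | hw
  · rw [continuousAt_iff_punctured_nhds, chartAtInfty_zero]
    have h : Tendsto (fun w : ℂ => ((w⁻¹ : ℂ) : OnePoint ℂ)) (𝓝[≠] 0) (𝓝 OnePoint.infty) := by
      refine OnePoint.tendsto_coe_infty.comp ?_
      rw [coclosedCompact_eq_cocompact, ← cobounded_eq_cocompact]
      exact tendsto_inv₀_nhdsNE_zero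
    refine h.congr' ?_
    filter_upwards [self_mem_nhdsWithin] with v hv
    exact (chartAtInfty_of_ne hv).symm
  · have h : ContinuousAt (fun w : ℂ => ((w⁻¹ : ℂ) : OnePoint ℂ)) w :=
      OnePoint.continuous_coe.continuousAt.comp (continuousAt_inv₀ hw)
    refine h.congr ?_
    filter_upwards [isOpen_ne.mem_nhds hw] with v hv
    exact (chartAtInfty_of_ne hv).symm

/-- The inverse of the chart at infinity. -/
def coordAtInfty (x : OnePoint ℂ) : ℂ := x.elim 0 fun z => z⁻¹

theorem coordAtInfty_coe (z : ℂ) : coordAtInfty z = z⁻¹ := rfl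

theorem coordAtInfty_infty : coordAtInfty OnePoint.infty = 0 := rfl

theorem coordAtInfty_chartAtInfty (w : ℂ) : coordAtInfty (chartAtInfty w) = w := by
  rcases eq_or_ne w 0 with rfl | hw
  · rw [chartAtInfty_zero, coordAtInfty_infty]
  · rw [chartAtInfty_of_ne hw, coordAtInfty_coe, inv_inv]

theorem continuousAt_coordAtInfty {x : OnePoint ℂ} (hx : x ≠ ((0 : ℂ) : OnePoint ℂ)) :
    ContinuousAt coordAtInfty x := by
  induction x using OnePoint.rec with
  | infty =>
    rw [OnePoint.continuousAt_infty', coclosedCompact_eq_cocompact, ← cobounded_eq_cocompact]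
    exact tendsto_inv₀_cobounded
  | coe z =>
    rw [OnePoint.continuousAt_coe]
    exact continuousAt_inv₀ fun h => hx (by rw [h])

theorem coordAtInfty_mem_closedBall (hR : 0 < R) {x : OnePoint ℂ}
    (hx : x ∈ closure (sphereCompl (closedBall 0 R))) : coordAtInfty x ∈ closedBall (0 : ℂ) R⁻¹ := by
  induction x using OnePoint.rec with
  | infty => simp [coordAtInfty_infty, hR.le]
  | coe z =>
    rw [coe_mem_closure_sphereCompl hR] at hx
    rw [coordAtInfty_coe, mem_closedBall_zero_iff, norm_inv]
    exact inv_anti₀ hR hx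

theorem continuousOn_comp_inv (hR : 0 < R) {φ : OnePoint ℂ → ℝ}
    (hφ : ContinuousOn φ (frontier (sphereCompl (closedBall 0 R)))) :
    ContinuousOn (fun ζ : ℂ => φ ((ζ⁻¹ : ℂ) : OnePoint ℂ)) (sphere 0 R⁻¹) := by
  refine hφ.comp (OnePoint.continuous_coe.comp_continuousOn
    (continuousOn_inv₀.mono fun ζ hζ => ?_)) fun ζ hζ => ?_
  · rintro rfl
    simp [hR.ne] at hζ
  · rw [mem_sphere_zero_iff_norm] at hζ
    rw [coe_mem_frontier_sphereCompl hR, norm_inv, hζ, inv_inv]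

/-- The Dirichlet problem in the exterior of a disc is solvable. -/
theorem exists_isDirichletSolution (hR : 0 < R) {φ : OnePoint ℂ → ℝ}
    (hφ : ContinuousOn φ (frontier (sphereCompl (closedBall 0 R)))) :
    ∃ h, IsDirichletSolution (sphereCompl (closedBall 0 R)) φ h := by
  set H := poissonExtension R⁻¹ (fun ζ : ℂ => φ ((ζ⁻¹ : ℂ) : OnePoint ℂ)) with hHdef
  have hg := continuousOn_comp_inv hR hφ
  have hHh := harmonicOnNhd_poissonExtension (inv_pos.2 hR) hg
  refine ⟨fun x => H (coordAtInfty x), ?_, ⟨?_, ?_⟩, ?_⟩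
  · refine (continuousOn_poissonExtension (inv_pos.2 hR) hg).comp (fun x hx => ?_)
      fun x hx => coordAtInfty_mem_closedBall hR hx
    refine (continuousAt_coordAtInfty ?_).continuousWithinAt
    rintro rfl
    rw [coe_mem_closure_sphereCompl hR, norm_zero] at hx
    linarith
  · intro z hz
    rw [Set.mem_ofPred_eq, coe_mem_sphereCompl_closedBall] at hz
    have hz0 : z ≠ 0 := norm_pos_iff.1 (hR.trans hz)
    have hzb : z⁻¹ ∈ ball (0 : ℂ) R⁻¹ := by
      rw [mem_ball_zero_iff, norm_inv]
      exact inv_strictAnti₀ hR hz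
    -- Harmonicity passes from the chart `1/z` to the chart `z` by composing inversion with an
    -- analytic `F` whose real part is `H`.
    obtain ⟨F, hF, hFH⟩ :=
      InnerProductSpace.HarmonicOnNhd.exists_analyticOnNhd_ball_re_eq hHh
    have h1 : AnalyticAt ℂ (fun z => F z⁻¹) z :=
      (hF z⁻¹ hzb).comp (analyticAt_id.inv hz0)
    refine (InnerProductSpace.harmonicAt_congr_nhds ?_).1 h1.harmonicAt_re
    filter_upwards [(continuousAt_inv₀ hz0).preimage_mem_nhds (isOpen_ball.mem_nhds hzb)] with v hv
    exact hFH hv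
  · intro w hw
    rw [Set.mem_ofPred_eq, chartAtInfty_mem_sphereCompl hR] at hw
    simpa only [coordAtInfty_chartAtInfty] using hHh w hw
  · intro x hx
    induction x using OnePoint.rec with
    | infty => exact absurd hx (infty_notMem_frontier_sphereCompl R)
    | coe z =>
      rw [coe_mem_frontier_sphereCompl hR] at hx
      simp only [coordAtInfty_coe]
      rw [hHdef, poissonExtension_of_mem_sphere, inv_inv]
      rw [mem_sphere_zero_iff_norm, norm_inv, hx]

/-- The Poisson formula in the exterior of a disc. -/
theorem IsDirichletSolution.eq_circleAverage (hR : 0 < R) {φ h : OnePoint ℂ → ℝ}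
    (hh : IsDirichletSolution (sphereCompl (closedBall 0 R)) φ h) {z₀ : ℂ} (hz₀ : R < ‖z₀‖) :
    h z₀ = Real.circleAverage
      (poissonKernel 0 z₀⁻¹ • fun ζ : ℂ => φ ((ζ⁻¹ : ℂ) : OnePoint ℂ)) 0 R⁻¹ := by
  have hz0 : z₀ ≠ 0 := norm_pos_iff.1 (hR.trans hz₀)
  have hzb : z₀⁻¹ ∈ ball (0 : ℂ) R⁻¹ := by
    rw [mem_ball_zero_iff, norm_inv]
    exact inv_strictAnti₀ hR hz₀
  have hH : InnerProductSpace.HarmonicContOnCl (fun w => h (chartAtInfty w)) (ball 0 R⁻¹) := by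
    refine InnerProductSpace.HarmonicContOnCl.mk_ball (hh.harmonic.infinite.mono fun w hw => ?_) ?_
    · rwa [Set.mem_ofPred_eq, chartAtInfty_mem_sphereCompl hR]
    · exact hh.continuousOn.comp continuous_chartAtInfty.continuousOn fun w hw =>
        (chartAtInfty_mem_closure_sphereCompl hR).2 hw
  have h1 := hH.circleAverage_poissonKernel_smul hzb
  rw [chartAtInfty_of_ne (inv_ne_zero hz0), inv_inv] at h1
  rw [← h1]
  refine Real.circleAverage_congr_sphere fun ζ hζ => ?_
  rw [abs_of_pos (inv_pos.2 hR), mem_sphere_zero_iff_norm] at hζ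
  have hζ0 : ζ ≠ 0 := norm_pos_iff.1 (hζ ▸ inv_pos.2 hR)
  simp only [Pi.smul_apply', chartAtInfty_of_ne hζ0]
  rw [hh.boundary]
  rw [coe_mem_frontier_sphereCompl hR, norm_inv, hζ, inv_inv]

/-- The harmonic measure at `z₀` of the exterior of the disc of radius `R`. -/
def exteriorHarmonicMeasure (R : ℝ) (z₀ : ℂ) : Measure ℂ :=
  ((volume.restrict (Set.Ioc 0 (2 * Real.pi))).withDensity fun θ =>
    ENNReal.ofReal ((2 * Real.pi)⁻¹ * poissonKernel 0 z₀⁻¹ (circleMap 0 R⁻¹ θ))).map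
      fun θ => (circleMap 0 R⁻¹ θ)⁻¹

theorem measurable_inv_circleMap (R : ℝ) : Measurable fun θ => (circleMap 0 R⁻¹ θ)⁻¹ :=
  (continuous_circleMap 0 R⁻¹).measurable.inv

theorem measurable_poissonDensity (R : ℝ) (z₀ : ℂ) : Measurable fun θ =>
    ENNReal.ofReal ((2 * Real.pi)⁻¹ * poissonKernel 0 z₀⁻¹ (circleMap 0 R⁻¹ θ)) := by
  have h : Measurable fun θ => circleMap 0 R⁻¹ θ := (continuous_circleMap 0 R⁻¹).measurable
  simp only [poissonKernel_def]
  fun_prop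

theorem inv_mem_ball (hR : 0 < R) {z₀ : ℂ} (hz₀ : R < ‖z₀‖) : z₀⁻¹ ∈ ball (0 : ℂ) R⁻¹ := by
  rw [mem_ball_zero_iff, norm_inv]
  exact inv_strictAnti₀ hR hz₀

theorem poissonDensity_nonneg (hR : 0 < R) {z₀ : ℂ} (hz₀ : R < ‖z₀‖) (θ : ℝ) :
    0 ≤ (2 * Real.pi)⁻¹ * poissonKernel 0 z₀⁻¹ (circleMap 0 R⁻¹ θ) :=
  mul_nonneg (by positivity)
    (poissonKernel_nonneg (inv_mem_ball hR hz₀) (circleMap_mem_sphere' 0 R⁻¹ θ))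

theorem integral_exteriorHarmonicMeasure (hR : 0 < R) {z₀ : ℂ} (hz₀ : R < ‖z₀‖) {f : ℂ → ℝ}
    (hf : AEStronglyMeasurable f (exteriorHarmonicMeasure R z₀)) :
    ∫ z, f z ∂(exteriorHarmonicMeasure R z₀) =
      Real.circleAverage (poissonKernel 0 z₀⁻¹ • fun ζ => f ζ⁻¹) 0 R⁻¹ := by
  rw [exteriorHarmonicMeasure, integral_map (measurable_inv_circleMap R).aemeasurable hf,
    integral_withDensity_eq_integral_toReal_smul (measurable_poissonDensity R z₀)
      (Eventually.of_forall fun _ => ENNReal.ofReal_lt_top), Real.circleAverage_def,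
    intervalIntegral.integral_of_le Real.two_pi_pos.le, ← integral_smul]
  simp only [ENNReal.toReal_ofReal (poissonDensity_nonneg hR hz₀ _), smul_eq_mul, Pi.smul_apply',
    mul_assoc]

theorem isProbabilityMeasure_exteriorHarmonicMeasure (hR : 0 < R) {z₀ : ℂ} (hz₀ : R < ‖z₀‖) :
    IsProbabilityMeasure (exteriorHarmonicMeasure R z₀) := by
  have hb := inv_mem_ball hR hz₀
  have h1 := circleAverage_poissonKernel_smul_re_eval_add hb 0 1
  have hint : CircleIntegrable (poissonKernel 0 z₀⁻¹) 0 R⁻¹ :=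
    (continuousOn_poissonKernel_sphere hb).circleIntegrable'
  rw [CircleIntegrable, intervalIntegrable_iff_integrableOn_Ioc_of_le Real.two_pi_pos.le] at hint
  rw [Real.circleAverage_def, intervalIntegral.integral_of_le Real.two_pi_pos.le,
    ← integral_smul] at h1
  constructor
  rw [exteriorHarmonicMeasure, Measure.map_apply (measurable_inv_circleMap R) MeasurableSet.univ,
    Set.preimage_univ, withDensity_apply _ MeasurableSet.univ, Measure.restrict_univ,
    ← ofReal_integral_eq_lintegral_ofReal (hint.const_mul _)
      (Eventually.of_forall (poissonDensity_nonneg hR hz₀))]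
  simp only [Pi.smul_apply', Polynomial.eval_zero, Complex.zero_re, zero_add, smul_eq_mul,
    mul_one] at h1
  rw [h1, ENNReal.ofReal_one]

theorem ae_norm_eq_exteriorHarmonicMeasure (hR : 0 < R) (z₀ : ℂ) :
    ∀ᵐ z ∂(exteriorHarmonicMeasure R z₀), z ∈ sphere (0 : ℂ) R := by
  rw [exteriorHarmonicMeasure, ae_map_iff (p := fun z => z ∈ sphere (0 : ℂ) R)
    (measurable_inv_circleMap R).aemeasurable isClosed_sphere.measurableSet]
  refine Eventually.of_forall fun θ => ?_
  simp [abs_of_pos hR]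

theorem isHarmonicMeasure_exteriorHarmonicMeasure (hR : 0 < R) {z₀ : ℂ} (hz₀ : R < ‖z₀‖) :
    IsHarmonicMeasure (sphereCompl (closedBall 0 R)) z₀ (exteriorHarmonicMeasure R z₀) where
  isProbabilityMeasure := isProbabilityMeasure_exteriorHarmonicMeasure hR hz₀
  carried := by
    filter_upwards [ae_norm_eq_exteriorHarmonicMeasure hR z₀] with z hz
    rwa [coe_mem_frontier_sphereCompl hR, ← mem_sphere_zero_iff_norm]
  dirichlet φ hφ := by
    obtain ⟨h, hh⟩ := exists_isDirichletSolution hR hφ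
    refine ⟨h, hh, ?_⟩
    have hc : ContinuousOn (fun z : ℂ => φ z) (sphere 0 R) :=
      hφ.comp OnePoint.continuous_coe.continuousOn fun z hz => by
        rwa [coe_mem_frontier_sphereCompl hR, ← mem_sphere_zero_iff_norm]
    have hm := hc.aestronglyMeasurable (μ := exteriorHarmonicMeasure R z₀)
      isClosed_sphere.measurableSet
    rw [Measure.restrict_eq_self_of_ae_mem (ae_norm_eq_exteriorHarmonicMeasure hR z₀)] at hm
    rw [integral_exteriorHarmonicMeasure hR hz₀ hm, hh.eq_circleAverage hR hz₀]

/-- Any Dirichlet solution is the Poisson integral of its boundary values, so the integrals of all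
bounded continuous functions are determined, hence so is the measure. The value `0` assigned at
infinity is harmless, as infinity is not a boundary point. -/
theorem IsHarmonicMeasure.eq_exteriorHarmonicMeasure (hR : 0 < R) {z₀ : ℂ} (hz₀ : R < ‖z₀‖)
    {ω : Measure ℂ} (hω : IsHarmonicMeasure (sphereCompl (closedBall 0 R)) z₀ ω) :
    ω = exteriorHarmonicMeasure R z₀ := by
  have := hω.isProbabilityMeasure
  have := isProbabilityMeasure_exteriorHarmonicMeasure hR hz₀
  refine ext_of_forall_integral_eq_of_IsFiniteMeasure fun f => ?_
  obtain ⟨h, hh, hint⟩ := hω.dirichlet (fun x => x.elim 0 f) (by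
    intro x hx
    induction x using OnePoint.rec with
    | infty => exact absurd hx (infty_notMem_frontier_sphereCompl R)
    | coe z =>
      refine ContinuousAt.continuousWithinAt ?_
      rw [OnePoint.continuousAt_coe]
      exact f.continuous.continuousAt)
  rw [hh.eq_circleAverage hR hz₀] at hint
  rw [integral_exteriorHarmonicMeasure hR hz₀ f.continuous.aestronglyMeasurable]
  exact hint.symm

end Sphere

/-! ### Convergence of the Berezin measures. -/

/-- A continuous function of polynomial growth which is small on the circle `|z| = R` is bounded by a
small constant plus a multiple of a radial weight vanishing on the circle. -/
theorem exists_abs_le_add_mul {R ε : ℝ} (hR : 0 < R) {F : ℂ → ℝ} (hF : Continuous F)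
    (hgrowth : HasPolyGrowth F) (hε : 0 < ε) (hsmall : ∀ z ∈ sphere (0 : ℂ) R, |F z| < ε) :
    ∃ (C : ℝ) (d : ℕ), 0 ≤ C ∧
      ∀ z, |F z| ≤ ε + C * ((‖z‖ ^ 2 - R ^ 2) ^ 2 * (1 + ‖z‖ ^ 2) ^ d) := by
  obtain ⟨C, d, hC, hF'⟩ := hgrowth.exists_nonneg
  -- Where `|F| ≥ ε`, the point is off the circle. Compactness bounds the weight below by some `δ`
  -- within radius `R + 1`, and beyond that radius `|z|² - R² ≥ 1`.
  have hK : IsCompact ({z | ε ≤ |F z|} ∩ closedBall 0 (R + 1)) :=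
    (isCompact_closedBall 0 (R + 1)).inter_left (isClosed_le continuous_const hF.abs)
  have hpos : ∀ z ∈ {z | ε ≤ |F z|} ∩ closedBall (0 : ℂ) (R + 1), 0 < (‖z‖ ^ 2 - R ^ 2) ^ 2 := by
    intro z hz
    refine lt_of_le_of_ne (sq_nonneg _) fun h => ?_
    have h' : ‖z‖ ^ 2 - R ^ 2 = 0 := (pow_eq_zero_iff two_ne_zero).1 h.symm
    have hz1 : ε ≤ |F z| := hz.1
    refine absurd (hsmall z ?_) (not_lt.2 hz1)
    rw [mem_sphere_zero_iff_norm]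
    exact (pow_left_inj₀ (norm_nonneg z) hR.le two_ne_zero).1 (by linarith)
  obtain ⟨δ, hδ, hδK⟩ := hK.exists_forall_le' (by fun_prop) hpos
  have hδ1 : 0 < min δ 1 := lt_min hδ one_pos
  refine ⟨C / min δ 1, d, by positivity, fun z => ?_⟩
  have h0 : 0 ≤ C / min δ 1 * ((‖z‖ ^ 2 - R ^ 2) ^ 2 * (1 + ‖z‖ ^ 2) ^ d) := by positivity
  rcases lt_or_ge |F z| ε with hz | hz
  · linarith
  have hδz : min δ 1 ≤ (‖z‖ ^ 2 - R ^ 2) ^ 2 := by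
    rcases le_or_gt ‖z‖ (R + 1) with hzR | hzR
    · exact (min_le_left _ _).trans (hδK z ⟨hz, by simpa using hzR⟩)
    · refine (min_le_right _ _).trans ?_
      have : 1 ≤ ‖z‖ ^ 2 - R ^ 2 := by nlinarith
      nlinarith
  have h1 : C * (1 + ‖z‖ ^ 2) ^ d ≤
      C / min δ 1 * ((‖z‖ ^ 2 - R ^ 2) ^ 2 * (1 + ‖z‖ ^ 2) ^ d) := by
    rw [div_mul_eq_mul_div, le_div_iff₀ hδ1]
    calc C * (1 + ‖z‖ ^ 2) ^ d * min δ 1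
        ≤ C * (1 + ‖z‖ ^ 2) ^ d * (‖z‖ ^ 2 - R ^ 2) ^ 2 := by gcongr
      _ = _ := by ring
  have h2 := hF' z
  rw [Real.norm_eq_abs] at h2
  linarith

section Limits

variable {ι : Type*} {l : Filter ι} {m : ι → ℝ} {n : ι → ℕ} {τ : ℝ} {w : ℂ}

theorem eventually_pos_and_one_le (hm : Tendsto m l atTop)
    (hn : Tendsto (fun i => (n i : ℝ) / m i) l (𝓝 τ)) (hτ : 0 < τ) :
    ∀ᶠ i in l, 0 < m i ∧ 1 ≤ n i := by
  filter_upwards [hm.eventually_gt_atTop 0, hn.eventually_const_lt hτ] with i h1 h3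
  exact ⟨h1, Nat.pos_of_ne_zero fun h => by simp [h] at h3⟩

theorem continuous_eval_norm_sq (q : Polynomial ℝ) : Continuous fun z : ℂ => q.eval (‖z‖ ^ 2) :=
  q.continuous.comp (continuous_norm.pow 2)

theorem hasPolyGrowth_eval_norm_sq (q : Polynomial ℝ) :
    HasPolyGrowth (fun z : ℂ => q.eval (‖z‖ ^ 2)) := by
  induction q using Polynomial.induction_on' with
  | add p q hp hq => simpa using hp.add hq
  | monomial n a => simpa using (hasPolyGrowth_const a).mul ((hasPolyGrowth_norm.pow 2).pow n)

theorem tendsto_integral_eval_norm_sq (hm : Tendsto m l atTop)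
    (hn : Tendsto (fun i => (n i : ℝ) / m i) l (𝓝 τ)) (hτ : 0 < τ) (hw : τ < ‖w‖ ^ 2)
    (q : Polynomial ℝ) :
    Tendsto (fun i => ∫ z, q.eval (‖z‖ ^ 2) ∂(fockBerezin (m i) (n i) w)) l (𝓝 (q.eval τ)) := by
  have hev := eventually_pos_and_one_le hm hn hτ
  induction q using Polynomial.induction_on' with
  | add p q hp hq =>
    rw [Polynomial.eval_add]
    refine (hp.add hq).congr' ?_
    filter_upwards [hev] with i ⟨h1, h2⟩
    simp only [Polynomial.eval_add]
    rw [integral_add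
      ((hasPolyGrowth_eval_norm_sq p).integrable_fockBerezin h1 (continuous_eval_norm_sq p) _ _)
      ((hasPolyGrowth_eval_norm_sq q).integrable_fockBerezin h1 (continuous_eval_norm_sq q) _ _)]
  | monomial k a =>
    rw [Polynomial.eval_monomial]
    refine ((tendsto_radialMoment hm hn hτ hw k).const_mul a).congr' ?_
    filter_upwards [hev] with i ⟨h1, h2⟩
    simp only [Polynomial.eval_monomial]
    rw [integral_const_mul, ← integral_norm_pow_fockBerezin h1 h2]
    simp only [pow_mul]

/-- The limit is evaluation at the reflection of `w` in the circle `|z|² = τ`, because `w^k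
(τ/|w|²)^k = (τ / conj w)^k`. -/
theorem tendsto_integral_eval (hm : Tendsto m l atTop)
    (hn : Tendsto (fun i => (n i : ℝ) / m i) l (𝓝 τ)) (hτ : 0 < τ) (hw : τ < ‖w‖ ^ 2)
    (p : Polynomial ℂ) :
    Tendsto (fun i => ∫ z, p.eval z ∂(fockBerezin (m i) (n i) w)) l
      (𝓝 (p.eval (τ * (starRingEnd ℂ) w⁻¹))) := by
  have hev := eventually_pos_and_one_le hm hn hτ
  have hw0 : w ≠ 0 := by
    rintro rfl
    simp at hw
    linarith
  induction p using Polynomial.induction_on' with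
  | add p q hp hq =>
    rw [Polynomial.eval_add]
    refine (hp.add hq).congr' ?_
    filter_upwards [hev] with i ⟨h1, h2⟩
    simp only [Polynomial.eval_add]
    rw [integral_add ((hasPolyGrowth_eval p).integrable_fockBerezin h1 p.continuous _ _)
      ((hasPolyGrowth_eval q).integrable_fockBerezin h1 q.continuous _ _)]
  | monomial k a =>
    have h := ((Complex.continuous_ofReal.tendsto _).comp
      (tendsto_expPartial_ratio hm hn hτ hw k)).const_mul (a * w ^ k)
    have hlim : a * w ^ k * (((τ / ‖w‖ ^ 2) ^ k : ℝ) : ℂ) =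
        (Polynomial.monomial k a).eval (τ * (starRingEnd ℂ) w⁻¹) := by
      have hc : (starRingEnd ℂ) w ≠ 0 := (map_ne_zero _).2 hw0
      rw [Polynomial.eval_monomial, mul_assoc, Complex.ofReal_pow, ← mul_pow, Complex.ofReal_div,
        ← mul_conj_eq, map_inv₀]
      congr 2
      field_simp
    rw [hlim] at h
    refine h.congr' ?_
    filter_upwards [hev] with i ⟨h1, h2⟩
    simp only [Polynomial.eval_monomial, Function.comp_apply]
    rw [integral_const_mul, integral_pow_fockBerezin h1 h2, mul_assoc]

/-- On `|ζ| = 1/R` one has `1/ζ = R² conj ζ`. So `Re p(1/ζ)` has the boundary values of `Re q`,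
where `q(ζ)` is the conjugate of `p(R² conj ζ)`, and the Poisson formula evaluates this at `1/w`. -/
theorem integral_re_eval_exteriorHarmonicMeasure {R : ℝ} (hR : 0 < R) (hw : R < ‖w‖)
    (p : Polynomial ℂ) :
    ∫ z, (p.eval z).re ∂(exteriorHarmonicMeasure R w) =
      (p.eval (((R ^ 2 : ℝ) : ℂ) * (starRingEnd ℂ) w⁻¹)).re := by
  set q : Polynomial ℂ :=
    (p.map (starRingEnd ℂ)).comp (Polynomial.C ((R ^ 2 : ℝ) : ℂ) * Polynomial.X) with hq
  have hqe : ∀ ζ : ℂ, (q.eval ζ).re = (p.eval (((R ^ 2 : ℝ) : ℂ) * (starRingEnd ℂ) ζ)).re := by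
    intro ζ
    have h1 : (Polynomial.C ((R ^ 2 : ℝ) : ℂ) * Polynomial.X).eval ζ =
        (starRingEnd ℂ) (((R ^ 2 : ℝ) : ℂ) * (starRingEnd ℂ) ζ) := by
      rw [map_mul, Complex.conj_ofReal, Complex.conj_conj, Polynomial.eval_mul, Polynomial.eval_C,
        Polynomial.eval_X]
    rw [hq, Polynomial.eval_comp, h1, Polynomial.eval_map, Polynomial.eval₂_at_apply,
      Complex.conj_re]
  have hc : Continuous fun z => (p.eval z).re := Complex.continuous_re.comp p.continuous
  have h := circleAverage_poissonKernel_smul_re_eval_add (inv_mem_ball hR hw) q 0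
  simp only [add_zero] at h
  rw [integral_exteriorHarmonicMeasure hR hw hc.aestronglyMeasurable, ← hqe, ← h]
  refine Real.circleAverage_congr_sphere fun ζ hζ => ?_
  rw [abs_of_pos (inv_pos.2 hR), mem_sphere_zero_iff_norm] at hζ
  have hζ0 : ζ ≠ 0 := norm_pos_iff.1 (hζ ▸ inv_pos.2 hR)
  have h2 : ζ⁻¹ = ((R ^ 2 : ℝ) : ℂ) * (starRingEnd ℂ) ζ := by
    have h3 := mul_conj_eq ζ
    rw [hζ] at h3
    refine inv_eq_of_mul_eq_one_right ?_
    rw [mul_left_comm, h3, ← Complex.ofReal_mul, inv_pow, mul_inv_cancel₀ (by positivity),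
      Complex.ofReal_one]
  simp only [Pi.smul_apply', hqe, ← h2]

theorem tendsto_integral_fockBerezin {R : ℝ} (hR : 0 < R) (hw : R < ‖w‖)
    (hm : Tendsto m l atTop) (hn : Tendsto (fun i => (n i : ℝ) / m i) l (𝓝 (R ^ 2)))
    (f : BoundedContinuousFunction ℂ ℝ) :
    Tendsto (fun i => ∫ z, f z ∂(fockBerezin (m i) (n i) w)) l
      (𝓝 (∫ z, f z ∂(exteriorHarmonicMeasure R w))) := by
  have hτ : 0 < R ^ 2 := by positivity
  have hw' : R ^ 2 < ‖w‖ ^ 2 := pow_lt_pow_left₀ hw hR.le two_ne_zero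
  have := isProbabilityMeasure_exteriorHarmonicMeasure hR hw
  have hsphere := ae_norm_eq_exteriorHarmonicMeasure hR w
  rw [Metric.tendsto_nhds]
  intro ε hε
  have hε4 : 0 < ε / 4 := by positivity
  obtain ⟨p, hp⟩ := exists_re_eval_approx hR f.continuous.continuousOn hε4
  have hpc : Continuous fun z => (p.eval z).re := Complex.continuous_re.comp p.continuous
  have hpg : HasPolyGrowth fun z => (p.eval z).re :=
    (hasPolyGrowth_eval p).of_norm_le fun z => Complex.abs_re_le_norm _
  have hfg : HasPolyGrowth f := ⟨‖f‖, 0, fun z => by simpa using f.norm_coe_le_norm z⟩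
  have hFg : HasPolyGrowth fun z => f z - (p.eval z).re := by
    simpa only [sub_eq_add_neg] using
      hfg.add (hpg.of_norm_le (g := fun z => -(p.eval z).re) fun z => by simp)
  have hFc : Continuous fun z => f z - (p.eval z).re := f.continuous.sub hpc
  obtain ⟨C, d, hC, hF⟩ := exists_abs_le_add_mul hR hFc hFg hε4 hp
  -- The majorant of `|f - Re p| - ε/4`, as a polynomial in `|z|²` with `q(R²) = 0`, so its Berezin
  -- integral tends to `0`. The other quarters of `ε` cover the constant part of this bound, the
  -- convergence for `p`, and the error under harmonic measure.
  set q : Polynomial ℝ := Polynomial.C C *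
    ((Polynomial.X - Polynomial.C (R ^ 2)) ^ 2 * (1 + Polynomial.X) ^ d) with hqdef
  have hqe : ∀ t, q.eval t = C * ((t - R ^ 2) ^ 2 * (1 + t) ^ d) := fun t => by simp [hqdef]
  have hq0 := tendsto_integral_eval_norm_sq hm hn hτ hw' q
  rw [hqe, sub_self] at hq0
  norm_num at hq0
  have hpre := ((Complex.continuous_re.tendsto _).comp (tendsto_integral_eval hm hn hτ hw' p))
  rw [← integral_re_eval_exteriorHarmonicMeasure hR hw] at hpre
  filter_upwards [eventually_pos_and_one_le hm hn hτ, hq0.eventually_lt_const hε4,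
    Metric.tendsto_nhds.1 hpre _ hε4] with i ⟨hmi, hni⟩ hqi hpi
  have := isProbabilityMeasure_fockBerezin hmi hni w
  have hpint := (hasPolyGrowth_eval p).integrable_fockBerezin hmi p.continuous (n i) w
  have hfint := hfg.integrable_fockBerezin hmi f.continuous (n i) w
  have hreint := hpg.integrable_fockBerezin hmi hpc (n i) w
  have hqint := (hasPolyGrowth_eval_norm_sq q).integrable_fockBerezin hmi
    (continuous_eval_norm_sq q) (n i) w
  have hFB : |∫ z, (f z - (p.eval z).re) ∂(fockBerezin (m i) (n i) w)| ≤
      ε / 4 + ∫ z, q.eval (‖z‖ ^ 2) ∂(fockBerezin (m i) (n i) w) := by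
    have h1 := norm_integral_le_of_norm_le (μ := fockBerezin (m i) (n i) w)
      (f := fun z => f z - (p.eval z).re) ((integrable_const (ε / 4)).add hqint)
      (Eventually.of_forall fun z => by simpa [hqe] using hF z)
    simp only [Pi.add_apply] at h1
    rw [integral_add (integrable_const _) hqint, integral_const] at h1
    simpa using h1
  have hFω : |∫ z, (f z - (p.eval z).re) ∂(exteriorHarmonicMeasure R w)| ≤ ε / 4 := by
    have h1 := norm_integral_le_of_norm_le_const (μ := exteriorHarmonicMeasure R w)
      (f := fun z => f z - (p.eval z).re) (C := ε / 4)
      (hsphere.mono fun z hz => (hp z hz).le)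
    simpa using h1
  have hpω : Integrable (fun z => (p.eval z).re) (exteriorHarmonicMeasure R w) := by
    obtain ⟨B, hB⟩ := (isCompact_sphere (0 : ℂ) R).exists_bound_of_continuousOn hpc.continuousOn
    exact (integrable_const B).mono' hpc.aestronglyMeasurable (hsphere.mono hB)
  have hre : (∫ z, p.eval z ∂(fockBerezin (m i) (n i) w)).re =
      ∫ z, (p.eval z).re ∂(fockBerezin (m i) (n i) w) :=
    (Complex.reCLM.integral_comp_comm hpint).symm
  simp only [Function.comp_apply] at hpi
  rw [integral_sub hfint hreint] at hFB
  rw [integral_sub (f.integrable _) hpω] at hFω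
  rw [hre, Real.dist_eq, abs_lt] at hpi
  rw [Real.dist_eq, abs_lt]
  rw [abs_le] at hFB hFω
  constructor <;> linarith [hpi.1, hpi.2, hFB.1, hFB.2, hFω.1, hFω.2]

end Limits

end Berezin

end

theorem theorem2p5 (τ : ℝ) (hτ : 0 < τ) :
    Berezin.coincidenceSet Berezin.fockWeight τ = Metric.closedBall (0 : ℂ) (Real.sqrt τ) ∧
    ∀ z₀ : ℂ, z₀ ∉ Berezin.coincidenceSet Berezin.fockWeight τ →
      (∀ m : ℝ, 0 < m → ∀ n : ℕ, 1 ≤ n →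
        IsProbabilityMeasure (Berezin.berezinMeasure Berezin.fockWeight m n z₀)) ∧
      ∃ ω : Measure ℂ,
        Berezin.IsHarmonicMeasure
          (Berezin.sphereCompl (Berezin.coincidenceSet Berezin.fockWeight τ)) z₀ ω ∧
        (∀ ω' : Measure ℂ, Berezin.IsHarmonicMeasure
          (Berezin.sphereCompl (Berezin.coincidenceSet Berezin.fockWeight τ)) z₀ ω' → ω' = ω) ∧
        ∀ f : BoundedContinuousFunction ℂ ℝ,
          Tendsto (fun p : ℝ × ℕ =>
              ∫ z, f z ∂(Berezin.berezinMeasure Berezin.fockWeight p.1 p.2 z₀))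
            (Berezin.scalingLimit τ) (𝓝 (∫ z, f z ∂ω)) := by
  refine ⟨Berezin.coincidenceSet_fockWeight hτ, fun z₀ hz₀ =>
    ⟨fun m hm n hn => Berezin.isProbabilityMeasure_fockBerezin hm hn z₀, ?_⟩⟩
  have hR : 0 < Real.sqrt τ := Real.sqrt_pos.2 hτ
  rw [Berezin.coincidenceSet_fockWeight hτ] at hz₀ ⊢
  have hz : Real.sqrt τ < ‖z₀‖ := by simpa using hz₀
  refine ⟨Berezin.exteriorHarmonicMeasure (Real.sqrt τ) z₀,
    Berezin.isHarmonicMeasure_exteriorHarmonicMeasure hR hz,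
    fun ω' hω' => hω'.eq_exteriorHarmonicMeasure hR hz, fun f => ?_⟩
  refine Berezin.tendsto_integral_fockBerezin (l := Berezin.scalingLimit τ) hR hz
    (tendsto_comap.mono_left inf_le_left) ?_ f
  rw [Real.sq_sqrt hτ.le]
  exact tendsto_comap.mono_left inf_le_right
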